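/- Let $\mathcal D$ be a triangulated category with Grothendieck group $K(\mathcal D)$. Let $S$ be the set of \emph{polynomial phase functions}: germs at $+\infty$ of continuous functions $\phi\colon \mathbb R\cup\{+\infty\}\to\mathbb R$ for which there is a polynomial $p\in\mathbb C[m]$ with $p(m)\in\mathbb R_{>0}\,e^{\pi i\phi(m)}$ for $m\gg 0$. It is linearly ordered by $\phi\prec\psi \Leftrightarrow \phi(m)<\psi(m)$ for $0\ll m<+\infty$, and $\phi+c$ ($c\in\mathbb R$) is defined pointwise. An ($S$-valued) \emph{slicing} $\mathcal P$ of $\mathcal D$ is a family of full additive extension-closed subcategories $\mathcal P(\phi)$, $\phi\in S$, such that $\mathcal P(\phi+1)=\mathcal P(\phi)[1]$; $\operatorname{Hom}(A,B)=0$ for $A\in\mathcal P(\phi)$, $B\in\mathcal P(\psi)$, $\phi\succ\psi$; and every $E\neq 0$ has a Harder--Narasimhan filtration, i.e. a finite sequence of exact triangles $E_{i-1}\to E_i\to A_i\to E_{i-1}[1]$ ($1\le i\le n$), $E_0=0$, $E_n=E$, with $0\ne A_i\in\mathcal P(\phi_i)$ and $\phi_1\succ\dots\succ\phi_n$; put $\phi^+_{\mathcal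 P}(E)=\phi_1$ and $\phi^-_{\mathcal P}(E)=\phi_n$. A \emph{polynomial stability condition} is a pair $\sigma=(Z,\mathcal P)$ of a group homomorphism $Z\colon K(\mathcal D)\to\mathbb C[m]$ and a slicing $\mathcal P$ with $Z(E)(m)\in\mathbb R_{>0}\,e^{\pi i\phi(m)}$ for $m\gg0$ whenever $0\neq E\in\mathcal P(\phi)$. For an interval $I\subset S$, let $\mathcal P(I)$ be the smallest extension-closed full subcategory containing all $\mathcal P(\phi)$, $\phi\in I$. The pair $\sigma$ is \emph{locally finite} if there is a real number $0<\eta\le\frac12$ such that for every $\phi\in S$ the quasi-abelian category $\mathcal P((\phi-\eta,\phi+\eta))$ is of finite length, i.e. for each of its objects, ascending and descending chains of strict subobjects (subobjects which are kernels) stabilise. For slicings $\mathcal P,\mathcal Q$ put $$d_S(\mathcal P,\mathcal Q)=\sup_{0\ne X\in\mathcal D}\max\bigl\{|\phi^-_{\mathcal P}(X)(+\infty)-\phi^-_{\mathcal Q}(X)(+\infty)|,\ |\phi^+_{\mathcal P}(X)(+\infty)-\phi^+_{\mathcal Q}(X)(+\infty)|\bigr\}\in[0,\infty],$$ and for a group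 homomorphism $U\colon K(\mathcal D)\to\mathbb C[m]$ put $$\|U\|_\sigma=\sup\Bigl\{\limsup_{m\to\infty}\frac{|U(E)(m)|}{|Z(E)(m)|}\ :\ 0\neq E\in\mathcal P(\phi)\text{ for some }\phi\in S\Bigr\}\in[0,\infty].$$ \textbf{Theorem.} Let $\sigma=(Z,\mathcal P)$ be a locally finite polynomial stability condition on $\mathcal D$. Then there is a real number $\epsilon$ with $0<\epsilon<\frac14$ such that for every group homomorphism $W\colon K(\mathcal D)\to\mathbb C[m]$ with $\|W-Z\|_\sigma<\sin(\pi\epsilon)$ there is a locally finite polynomial stability condition $\tau=(W,\mathcal Q)$ on $\mathcal D$ with $d_S(\mathcal P,\mathcal Q)<\epsilon$. -/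

import Mathlib

open CategoryTheory CategoryTheory.Limits CategoryTheory.Pretriangulated Filter Topology
open scoped Polynomial ENNReal

universe v u

noncomputable section

/-! ### Polynomial phase functions -/

/-- `p(m) ∈ ℝ_{>0} · exp (π i f(m))` for all real `m ≫ 0`. -/
def HasPhaseFun (p : ℂ[X]) (f : ℝ → ℝ) : Prop :=
  ∀ᶠ m : ℝ in atTop, ∃ r : ℝ, 0 < r ∧
    p.eval (m : ℂ) = (r : ℂ) * Complex.exp (Real.pi * f m * Complex.I)

/-- `f`, together with the value `l` at `+∞`, is continuous on a neighbourhood of `+∞` in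
`ℝ ∪ {+∞}`, and is the phase of some polynomial. -/
structure IsPolyPhaseFun (f : ℝ → ℝ) (l : ℝ) : Prop where
  continuousAt : ∀ᶠ m : ℝ in atTop, ContinuousAt f m
  tendsto : Tendsto f atTop (𝓝 l)
  exists_poly : ∃ p : ℂ[X], HasPhaseFun p f

/-- The set `S` of polynomial phase functions: germs at `+∞` of continuous functions
`ℝ ∪ {+∞} → ℝ` which are phases of polynomials. Such a germ is recorded as the germ of its
restriction to `ℝ` together with its value `infty` at `+∞`. -/
structure PolyPhase where
  germ : Germ (atTop : Filter ℝ) ℝ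
  infty : ℝ
  isPhase : ∃ f : ℝ → ℝ, (f : Germ (atTop : Filter ℝ) ℝ) = germ ∧ IsPolyPhaseFun f infty

/-- `p(m) ∈ ℝ_{>0} · exp (π i φ(m))` for `m ≫ 0` (independent of the representative `f`). -/
def PolyPhase.IsPhaseOf (φ : PolyPhase) (p : ℂ[X]) : Prop :=
  ∃ f : ℝ → ℝ, (f : Germ (atTop : Filter ℝ) ℝ) = φ.germ ∧ HasPhaseFun p f

theorem HasPhaseFun.add_const {p : ℂ[X]} {f : ℝ → ℝ} (h : HasPhaseFun p f) (c : ℝ) :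
    HasPhaseFun (Polynomial.C (Complex.exp (Real.pi * c * Complex.I)) * p)
      (fun m => f m + c) := by
  filter_upwards [h] with m hm
  obtain ⟨r, hr, e⟩ := hm
  refine ⟨r, hr, ?_⟩
  rw [Polynomial.eval_mul, Polynomial.eval_C, e, mul_left_comm, ← Complex.exp_add]
  congr 2
  push_cast
  ring

theorem IsPolyPhaseFun.add_const {f : ℝ → ℝ} {l : ℝ} (h : IsPolyPhaseFun f l) (c : ℝ) :
    IsPolyPhaseFun (fun m => f m + c) (l + c) where
  continuousAt := h.continuousAt.mono fun _ hm => hm.add continuousAt_const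
  tendsto := h.tendsto.add_const c
  exists_poly := by
    obtain ⟨p, hp⟩ := h.exists_poly
    exact ⟨_, hp.add_const c⟩

/-- The phase `φ + c`, obtained by pointwise addition of the real number `c`;
the shift on `S` is `φ ↦ φ + 1`. -/
instance : HAdd PolyPhase ℝ PolyPhase where
  hAdd φ c :=
    { germ := φ.germ.map (fun x => x + c)
      infty := φ.infty + c
      isPhase := by
        obtain ⟨f, hf, h⟩ := φ.isPhase
        exact ⟨fun m => f m + c, by rw [← hf]; rfl, h.add_const c⟩ }

theorem real_poly_sign (r : Polynomial ℝ) :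
    (∀ᶠ m : ℝ in atTop, r.eval m < 0) ∨ (∀ᶠ m : ℝ in atTop, r.eval m = 0) ∨
      (∀ᶠ m : ℝ in atTop, 0 < r.eval m) := by
  by_cases hd : 0 < r.degree
  · rcases le_total 0 r.leadingCoeff with h | h
    · exact Or.inr (Or.inr
        ((r.tendsto_atTop_of_leadingCoeff_nonneg hd h).eventually_gt_atTop 0))
    · exact Or.inl ((r.tendsto_atBot_of_leadingCoeff_nonpos hd h).eventually_lt_atBot 0)
  · rw [Polynomial.eq_C_of_degree_le_zero (not_lt.mp hd)]
    simp only [Polynomial.eval_C]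
    rcases lt_trichotomy (r.coeff 0) 0 with h | h | h
    · exact Or.inl (Eventually.of_forall fun _ => h)
    · exact Or.inr (Or.inl (Eventually.of_forall fun _ => h))
    · exact Or.inr (Or.inr (Eventually.of_forall fun _ => h))

theorem exists_im_poly (p : ℂ[X]) :
    ∃ r : Polynomial ℝ, ∀ m : ℝ, r.eval m = (p.eval (m : ℂ)).im := by
  induction p using Polynomial.induction_on' with
  | add p q hp hq =>
    obtain ⟨r, hr⟩ := hp
    obtain ⟨s, hs⟩ := hq
    exact ⟨r + s, fun m => by simp [hr, hs]⟩
  | monomial n a =>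
    refine ⟨Polynomial.monomial n a.im, fun m => ?_⟩
    rw [Polynomial.eval_monomial, Polynomial.eval_monomial, ← Complex.ofReal_pow,
      Complex.im_mul_ofReal]

theorem poly_conj_eval (p : ℂ[X]) (m : ℝ) :
    (p.map (starRingEnd ℂ)).eval (m : ℂ) = (starRingEnd ℂ) (p.eval (m : ℂ)) := by
  conv_lhs => rw [← Complex.conj_ofReal m]
  rw [Polynomial.eval_map_apply]

/-- Two polynomial phase functions are comparable for `m ≫ 0`. -/
theorem IsPolyPhaseFun.trichotomy {f g : ℝ → ℝ} {l k : ℝ} (hf : IsPolyPhaseFun f l)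
    (hg : IsPolyPhaseFun g k) :
    (∀ᶠ m in atTop, f m < g m) ∨ (∀ᶠ m in atTop, f m = g m) ∨ (∀ᶠ m in atTop, g m < f m) := by
  rcases lt_trichotomy l k with h | h | h
  · exact Or.inl (hf.tendsto.eventually_lt hg.tendsto h)
  · obtain ⟨p, hp⟩ := hf.exists_poly
    obtain ⟨q, hq⟩ := hg.exists_poly
    obtain ⟨r, hr⟩ := exists_im_poly (p * q.map (starRingEnd ℂ))
    have key : ∀ᶠ m in atTop, ∃ s : ℝ, 0 < s ∧
        r.eval m = s * Real.sin (Real.pi * (f m - g m)) := by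
      filter_upwards [hp, hq] with m h1 h2
      obtain ⟨a, ha, ea⟩ := h1
      obtain ⟨b, hb, eb⟩ := h2
      refine ⟨a * b, mul_pos ha hb, ?_⟩
      have e : (p * q.map (starRingEnd ℂ)).eval (m : ℂ) =
          ((a * b : ℝ) : ℂ) * Complex.exp (((Real.pi * (f m - g m) : ℝ) : ℂ) * Complex.I) := by
        rw [Polynomial.eval_mul, poly_conj_eval, ea, eb, map_mul, ← Complex.exp_conj]
        simp only [map_mul, Complex.conj_ofReal, Complex.conj_I]
        rw [mul_mul_mul_comm, ← Complex.exp_add]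
        push_cast
        congr 2
        ring
      rw [hr, e, Complex.im_ofReal_mul, Complex.exp_ofReal_mul_I_im]
    have hd : Tendsto (fun m => f m - g m) atTop (𝓝 0) := by
      have := hf.tendsto.sub hg.tendsto
      rwa [h, sub_self] at this
    have h1 : ∀ᶠ m in atTop, f m - g m < 1 := hd.eventually_lt_const one_pos
    have h2 : ∀ᶠ m in atTop, -1 < f m - g m := hd.eventually_const_lt (by norm_num)
    have hpos : ∀ x : ℝ, 0 < x → x < 1 → 0 < Real.sin (Real.pi * x) := fun x hx hx' =>
      Real.sin_pos_of_pos_of_lt_pi (by positivity) (by nlinarith [Real.pi_pos])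
    have hneg : ∀ x : ℝ, x < 0 → -1 < x → Real.sin (Real.pi * x) < 0 := fun x hx hx' => by
      have := hpos (-x) (by linarith) (by linarith)
      rw [mul_neg, Real.sin_neg] at this
      linarith
    rcases real_poly_sign r with hs | hs | hs
    · left
      filter_upwards [key, h1, h2, hs] with m ⟨s, hs0, es⟩ a b c
      by_contra! hle
      rcases hle.eq_or_lt with e | e
      · rw [es, e] at c
        simp at c
      · rw [es] at c
        have := mul_pos hs0 (hpos (f m - g m) (by linarith) a)
        linarith
    · right; left
      filter_upwards [key, h1, h2, hs] with m ⟨s, hs0, es⟩ a b c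
      rw [es] at c
      rcases lt_trichotomy (f m) (g m) with e | e | e
      · have := mul_neg_of_pos_of_neg hs0 (hneg (f m - g m) (by linarith) b)
        linarith
      · exact e
      · have := mul_pos hs0 (hpos (f m - g m) (by linarith) a)
        linarith
    · right; right
      filter_upwards [key, h1, h2, hs] with m ⟨s, hs0, es⟩ a b c
      by_contra! hle
      rcases hle.eq_or_lt with e | e
      · rw [es, e] at c
        simp at c
      · rw [es] at c
        have := mul_neg_of_pos_of_neg hs0 (hneg (f m - g m) (by linarith) b)
        linarith
  · exact Or.inr (Or.inr (hg.tendsto.eventually_lt hf.tendsto h))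

namespace PolyPhase

/-- A polynomial phase function is determined by its germ on `ℝ`. -/
theorem ext_germ {φ ψ : PolyPhase} (h : φ.germ = ψ.germ) : φ = ψ := by
  obtain ⟨G, a, f, hf, hfa⟩ := φ
  obtain ⟨H, b, g, hg, hgb⟩ := ψ
  dsimp only at h hf hg
  subst hf hg
  have hab : a = b :=
    tendsto_nhds_unique (hfa.tendsto.congr' (Germ.coe_eq.mp h)) hgb.tendsto
  subst hab
  congr

/-- `φ ≺ ψ` if and only if `φ(m) < ψ(m)` for `0 ≪ m < +∞`. -/
instance : LT PolyPhase where
  lt φ ψ := Germ.LiftRel (· < ·) φ.germ ψ.germ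

theorem lt_iff (φ ψ : PolyPhase) : φ < ψ ↔ Germ.LiftRel (· < ·) φ.germ ψ.germ := Iff.rfl

theorem lt_trichotomy' (φ ψ : PolyPhase) : φ < ψ ∨ φ = ψ ∨ ψ < φ := by
  obtain ⟨f, hf, hfa⟩ := φ.isPhase
  obtain ⟨g, hg, hgb⟩ := ψ.isPhase
  rw [lt_iff, lt_iff, ← hf, ← hg]
  rcases hfa.trichotomy hgb with h | h | h
  · exact Or.inl h
  · refine Or.inr (Or.inl (ext_germ ?_))
    rw [← hf, ← hg]
    exact Germ.coe_eq.mpr h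
  · exact Or.inr (Or.inr h)

theorem lt_irrefl' (φ : PolyPhase) : ¬ φ < φ := by
  obtain ⟨f, hf, -⟩ := φ.isPhase
  rw [lt_iff, ← hf]
  intro h
  obtain ⟨m, hm⟩ := (Germ.liftRel_coe.mp h).exists
  exact lt_irrefl _ hm

theorem lt_trans' {φ ψ χ : PolyPhase} (h₁ : φ < ψ) (h₂ : ψ < χ) : φ < χ := by
  obtain ⟨f, hf, -⟩ := φ.isPhase
  obtain ⟨g, hg, -⟩ := ψ.isPhase
  obtain ⟨k, hk, -⟩ := χ.isPhase
  rw [lt_iff] at h₁ h₂ ⊢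
  rw [← hf, ← hg] at h₁
  rw [← hg, ← hk] at h₂
  rw [← hf, ← hk]
  exact Germ.liftRel_coe.mpr ((Germ.liftRel_coe.mp h₁).mp
    ((Germ.liftRel_coe.mp h₂).mono fun _ b a => lt_trans a b))

/-- The linear order on polynomial phase functions. -/
instance : LinearOrder PolyPhase where
  le φ ψ := φ < ψ ∨ φ = ψ
  le_refl _ := Or.inr rfl
  le_trans φ ψ χ h₁ h₂ := by
    rcases h₁ with h₁ | rfl
    · rcases h₂ with h₂ | rfl
      · exact Or.inl (lt_trans' h₁ h₂)
      · exact Or.inl h₁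
    · exact h₂
  le_antisymm φ ψ h₁ h₂ := by
    rcases h₁ with h₁ | h₁
    · rcases h₂ with h₂ | h₂
      · exact absurd (lt_trans' h₁ h₂) (lt_irrefl' φ)
      · exact h₂.symm
    · exact h₁
  lt_iff_le_not_ge φ ψ := by
    constructor
    · refine fun h => ⟨Or.inl h, ?_⟩
      rintro (h' | rfl)
      · exact lt_irrefl' φ (lt_trans' h h')
      · exact lt_irrefl' ψ h
    · rintro ⟨h | h, h'⟩
      · exact h
      · exact absurd (Or.inr h.symm) h'
  le_total φ ψ := by
    rcases lt_trichotomy' φ ψ with h | h | h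
    · exact Or.inl (Or.inl h)
    · exact Or.inl (Or.inr h)
    · exact Or.inr (Or.inl h)
  toDecidableLE := Classical.decRel _

end PolyPhase

/-! ### Grothendieck group, slicings, central charges -/

section Triangulated

variable (C : Type u) [Category.{v} C] [HasZeroObject C] [HasShift C ℤ] [Preadditive C]
  [∀ n : ℤ, (shiftFunctor C n).Additive] [Pretriangulated C]

/-- The relations `[T.obj₂] = [T.obj₁] + [T.obj₃]` for all exact triangles `T`. -/
def K0Relations : AddSubgroup (FreeAbelianGroup C) :=
  AddSubgroup.closure {x | ∃ T ∈ distTriang C, x = FreeAbelianGroup.of T.obj₂ -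
    (FreeAbelianGroup.of T.obj₁ + FreeAbelianGroup.of T.obj₃)}

/-- The Grothendieck group `K(D)` of a triangulated category. -/
abbrev TriangulatedK0 : Type u := FreeAbelianGroup C ⧸ K0Relations C

variable {C}

/-- The class `[E]` in the Grothendieck group. -/
def k0Class (E : C) : TriangulatedK0 C :=
  QuotientAddGroup.mk (FreeAbelianGroup.of E)

/-- A Harder-Narasimhan filtration of `X` with respect to a family of subcategories `P φ`:
a sequence `0 ≅ E 0 ⟶ E 1 ⟶ ⋯ ⟶ E (n + 1) ≅ X` of morphisms fitting into exact triangles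
`E i ⟶ E (i + 1) ⟶ A i ⟶ (E i)⟦1⟧` with nonzero `A i` in `P (phase i)`, where
`phase 0 ≻ phase 1 ≻ ⋯ ≻ phase n`. -/
structure HNFiltration (P : PolyPhase → ObjectProperty C) (X : C) where
  n : ℕ
  phase : Fin (n + 1) → PolyPhase
  phase_anti : StrictAnti phase
  E : Fin (n + 2) → C
  A : Fin (n + 1) → C
  f : ∀ i : Fin (n + 1), E i.castSucc ⟶ E i.succ
  g : ∀ i : Fin (n + 1), E i.succ ⟶ A i
  h : ∀ i : Fin (n + 1), A i ⟶ (E i.castSucc)⟦(1 : ℤ)⟧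
  distinguished : ∀ i, Triangle.mk (f i) (g i) (h i) ∈ distTriang C
  isZero_bot : IsZero (E 0)
  isoTop : E (Fin.last (n + 1)) ≅ X
  semistable : ∀ i, P (phase i) (A i)
  nonzero : ∀ i, ¬ IsZero (A i)

variable (C) in
/-- An `S`-valued slicing, for `S` the set of polynomial phase functions. Each `P φ` is a full
replete subcategory containing `0` and closed under extensions (hence additive). -/
structure PolySlicing where
  P : PolyPhase → ObjectProperty C
  containsZero : ∀ φ, (P φ).ContainsZero
  closedIso : ∀ φ, (P φ).IsClosedUnderIsomorphisms
  closedExt : ∀ φ, ∀ T ∈ distTriang C, P φ T.obj₁ → P φ T.obj₃ → P φ T.obj₂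
  /-- `P(φ + 1) = P(φ)[1]` -/
  shift : ∀ (φ : PolyPhase) (E : C), P (φ + (1 : ℝ)) (E⟦(1 : ℤ)⟧) ↔ P φ E
  hom_eq_zero : ∀ φ ψ : PolyPhase, ψ < φ → ∀ A B : C, P φ A → P ψ B → ∀ f : A ⟶ B, f = 0
  exists_hn : ∀ E : C, ¬ IsZero E → Nonempty (HNFiltration P E)

variable (C) in
/-- A polynomial stability condition `(Z, P)` on a triangulated category. -/
structure PolyStabilityCondition where
  Z : TriangulatedK0 C →+ ℂ[X]
  slicing : PolySlicing C
  compat : ∀ (φ : PolyPhase) (E : C), slicing.P φ E → ¬ IsZero E → φ.IsPhaseOf (Z (k0Class E))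

/-! ### Local finiteness -/

/-- The smallest full subcategory which contains `P` and is closed under extensions. -/
inductive ExtensionClosure (P : ObjectProperty C) : ObjectProperty C
  | of (E : C) (h : P E) : ExtensionClosure P E
  | ext (T : Triangle C) (hT : T ∈ distTriang C) (h₁ : ExtensionClosure P T.obj₁)
      (h₃ : ExtensionClosure P T.obj₃) : ExtensionClosure P T.obj₂

/-- The subcategory `P(I) = ⟨P(φ) | φ ∈ I⟩`. -/
def PolySlicing.interval (s : PolySlicing C) (I : Set PolyPhase) : ObjectProperty C :=
  ExtensionClosure fun E => ∃ φ ∈ I, s.P φ E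

/-- The poset of strict subobjects of `E`, that is, of those subobjects whose inclusion is
the kernel of some morphism. -/
def StrictSubobject {A : Type u} [Category.{v} A] [HasZeroMorphisms A] (E : A) : Type (max u v) :=
  {X : Subobject E // Nonempty (NormalMono X.arrow)}

instance {A : Type u} [Category.{v} A] [HasZeroMorphisms A] (E : A) :
    PartialOrder (StrictSubobject E) :=
  inferInstanceAs (PartialOrder {X : Subobject E // Nonempty (NormalMono X.arrow)})

/-- A quasi-abelian category is of finite length if it is artinian and noetherian with respect
to strict subobjects: descending and ascending chains of strict subobjects stabilise. -/
def IsOfFiniteLength (A : Type u) [Category.{v} A] [HasZeroMorphisms A] : Prop :=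
  ∀ E : A, WellFoundedLT (StrictSubobject E) ∧ WellFoundedGT (StrictSubobject E)

/-- Local finiteness. The bound `ε ≤ 1 / 2` expresses that the interval `(φ - ε, φ + ε)` has
length at most `1`, the range in which `P((φ - ε, φ + ε))` is a quasi-abelian category. -/
def PolyStabilityCondition.IsLocallyFinite (σ : PolyStabilityCondition C) : Prop :=
  ∃ ε : ℝ, 0 < ε ∧ ε ≤ 1 / 2 ∧ ∀ φ : PolyPhase,
    IsOfFiniteLength (σ.slicing.interval (Set.Ioo (φ + (-ε)) (φ + ε))).FullSubcategory

/-! ### The semi-metric on slicings and the semi-norm on central charges -/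

/-- The Harder-Narasimhan filtration (it is unique up to isomorphism). -/
def PolySlicing.hn (s : PolySlicing C) (X : C) (hX : ¬ IsZero X) : HNFiltration s.P X :=
  (s.exists_hn X hX).some

/-- The highest phase `φ⁺(X)` in the Harder-Narasimhan filtration of `X ≠ 0`. -/
def PolySlicing.phiPlus (s : PolySlicing C) (X : C) (hX : ¬ IsZero X) : PolyPhase :=
  (s.hn X hX).phase 0

/-- The smallest phase `φ⁻(X)` in the Harder-Narasimhan filtration of `X ≠ 0`. -/
def PolySlicing.phiMinus (s : PolySlicing C) (X : C) (hX : ¬ IsZero X) : PolyPhase :=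
  (s.hn X hX).phase (Fin.last _)

/-- The semi-metric `d_S`: the pull-back of the semi-metric on `ℝ`-valued slicings along the
projection `S → ℝ`, `φ ↦ φ(+∞)`. -/
def PolySlicing.dist (s t : PolySlicing C) : ℝ≥0∞ :=
  ⨆ (X : C) (hX : ¬ IsZero X),
    max (ENNReal.ofReal |(s.phiMinus X hX).infty - (t.phiMinus X hX).infty|)
      (ENNReal.ofReal |(s.phiPlus X hX).infty - (t.phiPlus X hX).infty|)

/-- The semi-norm `‖U‖_σ`: the supremum over all nonzero `σ`-semistable `E` of
`limsup_{m → ∞} |U(E)(m)| / |Z(E)(m)|`. -/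
def PolyStabilityCondition.seminorm (σ : PolyStabilityCondition C)
    (U : TriangulatedK0 C →+ ℂ[X]) : ℝ≥0∞ :=
  ⨆ (φ : PolyPhase) (E : C) (_ : σ.slicing.P φ E) (_ : ¬ IsZero E),
    limsup (fun m : ℝ => ENNReal.ofReal
      (‖(U (k0Class E)).eval (m : ℂ)‖ / ‖(σ.Z (k0Class E)).eval (m : ℂ)‖)) atTop

end Triangulated

end

/-!
The slicing of the deformed stability condition is defined directly in terms of exact triangles:
`deformedP s W e ψ` consists of the objects whose original phases lie in `(ψ - e, ψ + e)`, whose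
`W`-phase is `ψ`, and none of whose subobjects has a bigger `W`-phase. Here a subobject of `E` is
the first vertex of an exact triangle with second vertex `E`, subject to bounds on the phases of the
first and of the third vertex (`IsExt`, `PolySlicing.In`), so that no abelian or quasi-abelian
structure is needed; the finite length hypothesis is translated into this language by
`PolySlicing.isOfFiniteLength_interval_iff`.

Phases are germs of functions. The ordered set of phases embeds into an ordered field
`PhaseField`, an ultraproduct of copies of `ℝ`, compatibly with translation by constants. Bounds on
phases thereby become linear inequalities over an ordered field.

Let `e` be small compared with the radius of local finiteness. If the seminorm of `W - Z` is less
than `sin (π e)`, then the `W`-phase of a semistable object differs from its original phase by less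
than `e` (`PolyPhase.IsPhaseOf.exists_of_norm_sub_lt`), and by the see-saw property the same holds
for objects in short intervals (`IsDeformation.exists_hasPhase`). This has the following
consequences.

* Morphisms from `deformedP ψ₁` to `deformedP ψ₂` vanish for `ψ₁ > ψ₂`
  (`IsDeformation.deformedP_hom_eq_zero`): when the phases are close, a nonzero morphism has an
  image `I`, a quotient of the source and a subobject of the target, whose phase would satisfy
  `ψ₁ ≤ phase I ≤ ψ₂`.
* An object which is semistable in a short interval, not too close to the end points, belongs to
  `deformedP` (`IsDeformation.deformedP_of_semistableIn`). Hence finite length produces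
  semistable subobjects and quotients.
* For each phase `t` there is a torsion pair separating the deformed phases `> t` from those `≤ t`
  (`IsDeformation.exists_torsion_pair`). The torsion and torsion-free classes are generated by
  deformed semistable objects together with objects whose original phases are far enough from `t`;
  this reduces the existence of the decomposition to objects of a short interval around `t`,
  where finite length yields a maximal torsion subobject and a maximal torsion-free quotient, and
  `IsDeformation.isZero_of_sub_of_quotient` shows that nothing is left between these.
* In a short interval, splitting an object repeatedly at its own phase terminates by finite length
  and gives the last Harder-Narasimhan factor (`IsDeformation.exists_last_factor`); a second
  induction gives the whole filtration, and the torsion pairs glue the filtrations of different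
  intervals (`IsDeformation.hasHN_of_tors_of_torsFree`).

Both slicings have their semistable objects at distance less than `e`, so their distance is at
most `e` (`PolySlicing.dist_le`), and local finiteness is inherited. Since the bound on
`W - Z` in the theorem is strict, `e` can be taken strictly smaller than the constant `ε`.
-/

open scoped ZeroObject

/-! ### Phases as elements of an ordered field -/

/-- The ultraproduct of `ℝ` along an ultrafilter finer than the neighbourhoods of `+∞`: an ordered
field into which the ordered set of phases embeds, compatibly with adding real constants. -/
abbrev PhaseField : Type := Germ (Ultrafilter.of (atTop : Filter ℝ) : Filter ℝ) ℝ

/-- The embedding of the real numbers into `PhaseField` as constants. -/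
noncomputable def cst : ℝ →+* PhaseField := (Germ.coeRingHom _).comp (Pi.constRingHom ℝ ℝ)

theorem cst_lt {a b : ℝ} : cst a < cst b ↔ a < b := Germ.const_lt_iff

theorem cst_le {a b : ℝ} : cst a ≤ cst b ↔ a ≤ b := by
  rw [← not_lt, cst_lt, not_lt]

namespace PolyPhase

/-- A chosen representative of the germ of a phase. -/
noncomputable def fn (φ : PolyPhase) : ℝ → ℝ := φ.isPhase.choose

theorem coe_fn (φ : PolyPhase) : (φ.fn : Germ (atTop : Filter ℝ) ℝ) = φ.germ :=
  φ.isPhase.choose_spec.1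

theorem isPolyPhaseFun_fn (φ : PolyPhase) : IsPolyPhaseFun φ.fn φ.infty :=
  φ.isPhase.choose_spec.2

theorem lt_iff_fn {φ ψ : PolyPhase} : φ < ψ ↔ ∀ᶠ m in atTop, φ.fn m < ψ.fn m := by
  rw [lt_iff, ← coe_fn, ← coe_fn, Germ.liftRel_coe]

theorem eq_iff_fn {φ ψ : PolyPhase} : φ = ψ ↔ ∀ᶠ m in atTop, φ.fn m = ψ.fn m := by
  constructor
  · rintro rfl
    exact Eventually.of_forall fun _ => rfl
  · intro h
    apply ext_germ
    rw [← coe_fn, ← coe_fn]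
    exact Germ.coe_eq.mpr h

theorem le_iff_fn {φ ψ : PolyPhase} : φ ≤ ψ ↔ ∀ᶠ m in atTop, φ.fn m ≤ ψ.fn m := by
  constructor
  · intro h
    rcases h.lt_or_eq with h | h
    · exact (lt_iff_fn.mp h).mono fun _ h => h.le
    · exact (eq_iff_fn.mp h).mono fun _ h => h.le
  · intro h
    by_contra! h'
    obtain ⟨m, h1, h2⟩ := (h.and (lt_iff_fn.mp h')).exists
    exact absurd h1 (not_le.mpr h2)

theorem fn_add (φ : PolyPhase) (c : ℝ) : ∀ᶠ m in atTop, (φ + c).fn m = φ.fn m + c := by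
  have : ((φ + c).fn : Germ (atTop : Filter ℝ) ℝ) = ((fun m => φ.fn m + c : ℝ → ℝ) : Germ _ ℝ) := by
    rw [coe_fn]
    change φ.germ.map _ = _
    rw [← coe_fn]
    rfl
  exact Germ.coe_eq.mp this

theorem infty_add (φ : PolyPhase) (c : ℝ) : (φ + c).infty = φ.infty + c := rfl

theorem isPhaseOf_iff {φ : PolyPhase} {p : ℂ[X]} : φ.IsPhaseOf p ↔ HasPhaseFun p φ.fn := by
  constructor
  · rintro ⟨f, hf, h⟩
    rw [← coe_fn] at hf
    filter_upwards [h, Germ.coe_eq.mp hf] with m hm e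
    rwa [← e]
  · exact fun h => ⟨_, φ.coe_fn, h⟩

/-- The embedding of the ordered set of phases into the ordered field `PhaseField`. -/
noncomputable def val (φ : PolyPhase) : PhaseField := (φ.fn : Germ _ ℝ)

theorem val_lt_of_lt {φ ψ : PolyPhase} (h : φ < ψ) : φ.val < ψ.val :=
  Germ.coe_lt.mpr (Ultrafilter.of_le _ (lt_iff_fn.mp h))

theorem val_lt {φ ψ : PolyPhase} : φ.val < ψ.val ↔ φ < ψ :=
  (show StrictMono val from fun _ _ h => val_lt_of_lt h).lt_iff_lt

theorem val_le {φ ψ : PolyPhase} : φ.val ≤ ψ.val ↔ φ ≤ ψ :=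
  (show StrictMono val from fun _ _ h => val_lt_of_lt h).le_iff_le

theorem val_inj {φ ψ : PolyPhase} : φ.val = ψ.val ↔ φ = ψ :=
  (show StrictMono val from fun _ _ h => val_lt_of_lt h).injective.eq_iff

theorem val_add (φ : PolyPhase) (c : ℝ) : (φ + c).val = φ.val + cst c :=
  Germ.coe_eq.mpr (Ultrafilter.of_le _ (φ.fn_add c))

theorem val_add_one (φ : PolyPhase) : (φ + (1 : ℝ)).val = φ.val + 1 := by
  rw [val_add, map_one]

theorem val_lt_add {φ ψ : PolyPhase} {c : ℝ} :
    φ.val < ψ.val + cst c ↔ ∀ᶠ m in atTop, φ.fn m < ψ.fn m + c := by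
  rw [← val_add, val_lt, lt_iff_fn]
  exact eventually_congr ((ψ.fn_add c).mono fun m h => by rw [h])

theorem lt_of_infty_lt {φ ψ : PolyPhase} (h : φ.infty < ψ.infty) : φ < ψ :=
  lt_iff_fn.mpr (φ.isPolyPhaseFun_fn.tendsto.eventually_lt ψ.isPolyPhaseFun_fn.tendsto h)

theorem infty_le_of_le {φ ψ : PolyPhase} (h : φ ≤ ψ) : φ.infty ≤ ψ.infty := by
  by_contra! h'
  exact absurd (lt_of_infty_lt h') (not_lt.mpr h)

theorem add_add (φ : PolyPhase) (a b : ℝ) : φ + a + b = φ + (a + b) := by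
  rw [← val_inj, val_add, val_add, val_add, map_add, add_assoc]

theorem add_zero' (φ : PolyPhase) : φ + (0 : ℝ) = φ := by
  rw [← val_inj, val_add, map_zero, add_zero]

end PolyPhase

/-! ### Phases of sums of polynomials -/

section Pointwise

open Real

/-- The imaginary part of a positive multiple of `exp (π i f)`, seen from the direction `θ`. -/
theorem sin_rotate_add {r s t f g h : ℝ}
    (e : (r : ℂ) * Complex.exp (π * f * Complex.I) + s * Complex.exp (π * g * Complex.I) =
      t * Complex.exp (π * h * Complex.I)) (θ : ℝ) :
    r * sin (π * (f - θ)) + s * sin (π * (g - θ)) = t * sin (π * (h - θ)) := by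
  have key : ∀ a x : ℝ, ((a : ℂ) * Complex.exp (π * x * Complex.I) *
      Complex.exp (-(π * θ * Complex.I))).im = a * sin (π * (x - θ)) := by
    intro a x
    rw [mul_assoc, ← Complex.exp_add, Complex.im_ofReal_mul]
    rw [show (π * x * Complex.I + -(π * θ * Complex.I) : ℂ) = ((π * (x - θ) : ℝ) : ℂ) * Complex.I by
      push_cast; ring, Complex.exp_ofReal_mul_I_im]
  rw [← key, ← key, ← key, ← e, ← Complex.add_im, add_mul]

theorem cos_rotate_add {r s t f g h : ℝ}
    (e : (r : ℂ) * Complex.exp (π * f * Complex.I) + s * Complex.exp (π * g * Complex.I) =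
      t * Complex.exp (π * h * Complex.I)) (θ : ℝ) :
    r * cos (π * (f - θ)) + s * cos (π * (g - θ)) = t * cos (π * (h - θ)) := by
  have key : ∀ a x : ℝ, ((a : ℂ) * Complex.exp (π * x * Complex.I) *
      Complex.exp (-(π * θ * Complex.I))).re = a * cos (π * (x - θ)) := by
    intro a x
    rw [mul_assoc, ← Complex.exp_add, Complex.re_ofReal_mul]
    rw [show (π * x * Complex.I + -(π * θ * Complex.I) : ℂ) = ((π * (x - θ) : ℝ) : ℂ) * Complex.I by
      push_cast; ring, Complex.exp_ofReal_mul_I_re]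
  rw [← key, ← key, ← key, ← e, ← Complex.add_re, add_mul]

theorem sin_pi_mul_pos {x : ℝ} (h0 : 0 < x) (h1 : x < 1) : 0 < sin (π * x) :=
  sin_pos_of_pos_of_lt_pi (by positivity) (by nlinarith [pi_pos])

theorem sin_pi_mul_neg {x : ℝ} (h0 : -1 < x) (h1 : x < 0) : sin (π * x) < 0 := by
  have := sin_pi_mul_pos (x := -x) (by linarith) (by linarith)
  rw [mul_neg, sin_neg] at this
  linarith

/-- If `sin (π x) = 0`, `cos (π x) > 0` and `|x| < 2`, then `x = 0`. -/
theorem eq_zero_of_sin_cos {x : ℝ} (h0 : -2 < x) (h1 : x < 2) (hs : sin (π * x) = 0)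
    (hc : 0 < cos (π * x)) : x = 0 := by
  rcases lt_trichotomy x 0 with h | h | h
  · exfalso
    rcases lt_trichotomy x (-1) with h' | h' | h'
    · have := sin_pi_mul_pos (x := x + 2) (by linarith) (by linarith)
      rw [mul_add, mul_comm π 2, sin_add_two_pi] at this
      linarith
    · rw [h'] at hc
      norm_num at hc
    · have := sin_pi_mul_neg h' h
      linarith
  · exact h
  · exfalso
    rcases lt_trichotomy x 1 with h' | h' | h'
    · have := sin_pi_mul_pos h h'
      linarith
    · rw [h'] at hc
      norm_num at hc
    · have := sin_pi_mul_neg (x := x - 2) (by linarith) (by linarith)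
      rw [mul_sub, mul_comm π 2, sin_sub_two_pi] at this
      linarith

/-- If the phases `f ≤ g` of two nonzero complex numbers differ by less than `1`, then the phase
`h ∈ [f, f + 2)` of their sum lies between them, strictly if `f < g`. -/
theorem phase_sum_between {r s t f g h : ℝ} (hr : 0 < r) (hs : 0 < s) (ht : 0 < t)
    (hfg : f ≤ g) (hgf : g < f + 1) (hfh : f ≤ h) (hhf : h < f + 2)
    (e : (r : ℂ) * Complex.exp (π * f * Complex.I) + s * Complex.exp (π * g * Complex.I) =
      t * Complex.exp (π * h * Complex.I)) :
    h ≤ g ∧ (f < g → f < h ∧ h < g) := by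
  have e1 := sin_rotate_add e f
  have e2 := cos_rotate_add e f
  have e3 := sin_rotate_add e g
  simp only [sub_self, mul_zero, sin_zero, cos_zero, zero_add, add_zero, mul_one] at e1 e2 e3
  rcases hfg.eq_or_lt with rfl | hlt
  · simp only [sub_self, mul_zero, sin_zero, cos_zero, mul_one] at e1 e2
    have := eq_zero_of_sin_cos (x := h - f) (by linarith) (by linarith)
      ((mul_eq_zero.mp e1.symm).resolve_left ht.ne')
      ((mul_pos_iff_of_pos_left ht).mp (by linarith))
    exact ⟨by linarith, fun h => absurd h (lt_irrefl _)⟩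
  · have h1 : 0 < sin (π * (h - f)) := by
      have := mul_pos hs (sin_pi_mul_pos (x := g - f) (by linarith) (by linarith))
      rw [e1] at this
      exact (mul_pos_iff_of_pos_left ht).mp this
    have h2 : f < h := by
      refine hfh.lt_of_ne ?_
      rintro rfl
      simp at h1
    have h3 : h < f + 1 := by
      by_contra! h3
      rcases h3.eq_or_lt with h3 | h3
      · rw [← h3] at h1
        simp at h1
      · have := sin_pi_mul_neg (x := h - f - 2) (by linarith) (by linarith)
        rw [mul_sub, mul_comm π 2, sin_sub_two_pi] at this
        linarith
    have h4 : sin (π * (h - g)) < 0 := by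
      have := mul_neg_of_pos_of_neg hr (sin_pi_mul_neg (x := f - g) (by linarith) (by linarith))
      rw [e3] at this
      by_contra! h4
      nlinarith
    have h5 : h < g := by
      by_contra! h5
      rcases h5.eq_or_lt with h5 | h5
      · rw [h5] at h4
        simp at h4
      · have := sin_pi_mul_pos (x := h - g) (by linarith) (by linarith)
        linarith
    exact ⟨h5.le, fun _ => ⟨h2, h5⟩⟩

end Pointwise

namespace PolyPhase

theorem IsPhaseOf.ne_zero {φ : PolyPhase} {p : ℂ[X]} (h : φ.IsPhaseOf p) : p ≠ 0 := by
  rintro rfl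
  obtain ⟨m, r, hr, e⟩ := (isPhaseOf_iff.mp h).exists
  rw [Polynomial.eval_zero, eq_comm, mul_eq_zero] at e
  rcases e with e | e
  · exact hr.ne' (by exact_mod_cast e)
  · exact Complex.exp_ne_zero _ e

/-- Two phases of the same polynomial which are closer than `2` agree. -/
theorem IsPhaseOf.unique {φ ψ : PolyPhase} {p : ℂ[X]} (hφ : φ.IsPhaseOf p) (hψ : ψ.IsPhaseOf p)
    (h1 : φ.val < ψ.val + 2) (h2 : ψ.val < φ.val + 2) : φ = ψ := by
  rw [← map_ofNat cst 2, val_lt_add] at h1 h2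
  rw [eq_iff_fn]
  filter_upwards [h1, h2, isPhaseOf_iff.mp hφ, isPhaseOf_iff.mp hψ] with m h1 h2 h3 h4
  obtain ⟨r, hr, e1⟩ := h3
  obtain ⟨s, hs, e2⟩ := h4
  have e : (r : ℂ) * Complex.exp (Real.pi * φ.fn m * Complex.I) +
      (0 : ℝ) * Complex.exp (Real.pi * (0 : ℝ) * Complex.I) =
      s * Complex.exp (Real.pi * ψ.fn m * Complex.I) := by
    rw [← e1, ← e2]
    simp
  have e3 := sin_rotate_add e (ψ.fn m)
  have e4 := cos_rotate_add e (ψ.fn m)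
  simp only [sub_self, mul_zero, zero_mul, add_zero, Real.sin_zero, Real.cos_zero, mul_one]
    at e3 e4
  have := eq_zero_of_sin_cos (x := φ.fn m - ψ.fn m) (by linarith) (by linarith)
      ((mul_eq_zero.mp e3).resolve_left hr.ne')
      ((mul_pos_iff_of_pos_left hr).mp (by linarith))
  linarith

theorem exists_of_isPolyPhaseFun {f : ℝ → ℝ} {l : ℝ} (h : IsPolyPhaseFun f l) {p : ℂ[X]}
    (hp : HasPhaseFun p f) : ∃ χ : PolyPhase, χ.IsPhaseOf p :=
  ⟨⟨f, l, f, rfl, h⟩, f, rfl, hp⟩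

/-- A polynomial is asymptotic to its leading term. -/
theorem tendsto_eval_div_leading {p : ℂ[X]} (hp : p ≠ 0) :
    Tendsto (fun m : ℝ => p.eval (m : ℂ) / (p.leadingCoeff * (m : ℂ) ^ p.natDegree)) atTop
      (𝓝 1) := by
  have hl : p.leadingCoeff ≠ 0 := Polynomial.leadingCoeff_ne_zero.mpr hp
  have h1 : Tendsto (fun m : ℝ => p.reverse.eval ((m : ℂ)⁻¹) / p.leadingCoeff) atTop
      (𝓝 (p.reverse.eval 0 / p.leadingCoeff)) := by
    refine Tendsto.div_const ((p.reverse.continuous.tendsto 0).comp ?_) _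
    have : Tendsto (fun m : ℝ => ((m⁻¹ : ℝ) : ℂ)) atTop (𝓝 ((0 : ℝ) : ℂ)) :=
      (Complex.continuous_ofReal.tendsto 0).comp tendsto_inv_atTop_zero
    simpa using this
  rw [← Polynomial.coeff_zero_eq_eval_zero, Polynomial.coeff_zero_reverse, div_self hl] at h1
  refine h1.congr' ?_
  filter_upwards [eventually_gt_atTop 0] with m hm
  have hm' : (m : ℂ) ≠ 0 := by exact_mod_cast hm.ne'
  let : Invertible (m : ℂ) := invertibleOfNonzero hm'
  have := Polynomial.eval₂_reverse_mul_pow (RingHom.id ℂ) (m : ℂ) p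
  rw [invOf_eq_inv] at this
  change p.reverse.eval _ * _ = p.eval _ at this
  rw [← this]
  field_simp

/-- Every nonzero polynomial has a phase: near `+∞` it is a small perturbation of its leading
term. -/
theorem exists_isPhaseOf {p : ℂ[X]} (hp : p ≠ 0) : ∃ χ : PolyPhase, χ.IsPhaseOf p := by
  set c := p.leadingCoeff with hc
  have hl : c ≠ 0 := Polynomial.leadingCoeff_ne_zero.mpr hp
  set q : ℝ → ℂ := fun m => p.eval (m : ℂ) / (c * (m : ℂ) ^ p.natDegree) with hq
  have ht : Tendsto q atTop (𝓝 1) := tendsto_eval_div_leading hp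
  have hslit : ∀ᶠ m in atTop, q m ∈ Complex.slitPlane :=
    ht.eventually (Complex.isOpen_slitPlane.mem_nhds Complex.one_mem_slitPlane)
  set f : ℝ → ℝ := fun m => (c.arg + (q m).arg) / Real.pi with hf
  have hphase : HasPhaseFun p f := by
    filter_upwards [hslit, eventually_gt_atTop 0] with m hm hm0
    refine ⟨‖c‖ * m ^ p.natDegree * ‖q m‖, ?_, ?_⟩
    · have := norm_pos_iff.mpr hl
      have := norm_pos_iff.mpr (Complex.slitPlane_ne_zero hm)
      positivity
    · have e1 : (Real.pi * f m * Complex.I : ℂ) = c.arg * Complex.I + (q m).arg * Complex.I := by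
        simp only [hf]
        push_cast
        field_simp [Real.pi_ne_zero]
      rw [e1, Complex.exp_add]
      push_cast
      have hm' : (m : ℂ) ^ p.natDegree ≠ 0 := pow_ne_zero _ (by exact_mod_cast hm0.ne')
      calc p.eval (m : ℂ) = c * (m : ℂ) ^ p.natDegree * q m := by
            simp only [hq]; field_simp
        _ = (‖c‖ * Complex.exp (c.arg * Complex.I)) * (m : ℂ) ^ p.natDegree *
            (‖q m‖ * Complex.exp ((q m).arg * Complex.I)) := by
            rw [Complex.norm_mul_exp_arg_mul_I, Complex.norm_mul_exp_arg_mul_I]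
        _ = _ := by ring
  refine exists_of_isPolyPhaseFun (f := f) (l := c.arg / Real.pi) ⟨?_, ?_, p, hphase⟩ hphase
  · filter_upwards [hslit, eventually_gt_atTop 0] with m hm hm0
    have hqc : ContinuousAt q m := by
      refine ContinuousAt.div ?_ ?_ ?_
      · exact (p.continuous.comp Complex.continuous_ofReal).continuousAt
      · exact (continuous_const.mul (Complex.continuous_ofReal.pow _)).continuousAt
      · exact mul_ne_zero hl (pow_ne_zero _ (by exact_mod_cast hm0.ne'))
    exact (continuousAt_const.add ((Complex.continuousAt_arg hm).comp hqc)).div_const _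
  · have h1 : Tendsto (fun m => (q m).arg) atTop (𝓝 (Complex.arg 1)) :=
      (Complex.continuousAt_arg Complex.one_mem_slitPlane).tendsto.comp ht
    rw [Complex.arg_one] at h1
    simpa using (h1.const_add c.arg).div_const Real.pi

theorem IsPhaseOf.add_two_mul_int {φ : PolyPhase} {p : ℂ[X]} (h : φ.IsPhaseOf p) (n : ℤ) :
    (φ + (2 * n : ℝ)).IsPhaseOf p := by
  rw [isPhaseOf_iff] at h ⊢
  filter_upwards [h, φ.fn_add (2 * n)] with m hm e
  obtain ⟨r, hr, e'⟩ := hm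
  refine ⟨r, hr, ?_⟩
  rw [e', e]
  congr 1
  rw [Complex.exp_eq_exp_iff_exists_int]
  refine ⟨-n, ?_⟩
  push_cast
  ring

/-- A nonzero polynomial has a phase in every half-open interval of length `2`. -/
theorem exists_isPhaseOf_mem_Ico {p : ℂ[X]} (hp : p ≠ 0) (φ : PolyPhase) :
    ∃ χ : PolyPhase, χ.IsPhaseOf p ∧ φ.val ≤ χ.val ∧ χ.val < φ.val + 2 := by
  obtain ⟨χ, hχ⟩ := exists_isPhaseOf hp
  set n : ℤ := ⌈(φ.infty - χ.infty) / 2⌉ with hn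
  have h1 := Int.le_ceil ((φ.infty - χ.infty) / 2)
  have h2 := Int.ceil_lt_add_one ((φ.infty - χ.infty) / 2)
  rw [← hn] at h1 h2
  have e2 : ∀ ψ : PolyPhase, ψ.val + 2 = (ψ + (2 : ℝ)).val := fun ψ => by
    rw [val_add, map_ofNat]
  rcases le_or_gt φ (χ + (2 * n : ℝ)) with h | h
  · refine ⟨_, hχ.add_two_mul_int n, val_le.mpr h, ?_⟩
    rw [e2, val_lt]
    apply lt_of_infty_lt
    rw [infty_add, infty_add]
    linarith
  · refine ⟨_, hχ.add_two_mul_int (n + 1), ?_, ?_⟩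
    · apply le_of_lt
      rw [val_lt]
      apply lt_of_infty_lt
      rw [infty_add]
      push_cast
      linarith
    · have h' := val_lt.mpr h
      rw [val_add] at h' ⊢
      push_cast
      rw [mul_add, map_add, mul_one, map_ofNat]
      linarith

/-- The sum of two polynomials whose phases differ by less than `1` has a phase between these,
strictly between them if they differ. -/
theorem IsPhaseOf.exists_add_of_le {φ ψ : PolyPhase} {p q : ℂ[X]} (hp : φ.IsPhaseOf p)
    (hq : ψ.IsPhaseOf q) (h1 : φ.val ≤ ψ.val) (h2 : ψ.val < φ.val + 1) :
    ∃ χ : PolyPhase, χ.IsPhaseOf (p + q) ∧ φ.val ≤ χ.val ∧ χ.val ≤ ψ.val ∧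
      (φ.val < ψ.val → φ.val < χ.val ∧ χ.val < ψ.val) := by
  rw [← map_one cst, val_lt_add] at h2
  rw [val_le, le_iff_fn] at h1
  have hne : p + q ≠ 0 := by
    intro h0
    obtain ⟨m, ⟨⟨r, hr, e1⟩, s, hs, e2⟩, h1, h2⟩ :=
      (((isPhaseOf_iff.mp hp).and (isPhaseOf_iff.mp hq)).and (h1.and h2)).exists
    have e0 : (r : ℂ) * Complex.exp (Real.pi * φ.fn m * Complex.I) +
        s * Complex.exp (Real.pi * ψ.fn m * Complex.I) =
        (0 : ℝ) * Complex.exp (Real.pi * (0 : ℝ) * Complex.I) := by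
      rw [← e1, ← e2, ← Polynomial.eval_add, h0]
      simp
    have e3 := sin_rotate_add e0 (φ.fn m)
    have e4 := cos_rotate_add e0 (φ.fn m)
    simp only [sub_self, mul_zero, zero_mul, zero_add, Real.sin_zero, Real.cos_zero, mul_one]
      at e3 e4
    rcases h1.eq_or_lt with h | h
    · rw [h] at e4
      simp at e4
      linarith
    · have := mul_pos hs (sin_pi_mul_pos (x := ψ.fn m - φ.fn m) (by linarith) (by linarith))
      linarith
  obtain ⟨χ, hχ, h3, h4⟩ := exists_isPhaseOf_mem_Ico hne φ
  have h3' := h3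
  rw [← map_ofNat cst 2, val_lt_add] at h4
  rw [val_le, le_iff_fn] at h3
  have key : ∀ᶠ m in atTop, χ.fn m ≤ ψ.fn m ∧
      (φ.fn m < ψ.fn m → φ.fn m < χ.fn m ∧ χ.fn m < ψ.fn m) := by
    filter_upwards [isPhaseOf_iff.mp hp, isPhaseOf_iff.mp hq, isPhaseOf_iff.mp hχ, h1, h2, h3, h4]
      with m ⟨r, hr, e1⟩ ⟨s, hs, e2⟩ ⟨t, ht, e3⟩ h1 h2 h3 h4
    refine phase_sum_between hr hs ht h1 h2 h3 h4 ?_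
    rw [← e1, ← e2, ← e3, Polynomial.eval_add]
  refine ⟨χ, hχ, h3', ?_, ?_⟩
  · rw [val_le, le_iff_fn]
    exact key.mono fun _ h => h.1
  · intro h
    rw [val_lt, lt_iff_fn] at h
    constructor
    · rw [val_lt, lt_iff_fn]
      filter_upwards [key, h] with m h1 h2 using (h1.2 h2).1
    · rw [val_lt, lt_iff_fn]
      filter_upwards [key, h] with m h1 h2 using (h1.2 h2).2

/-- The phase of a sum lies between the phases of the summands, strictly if these differ. -/
theorem IsPhaseOf.between_add {α β γ : PolyPhase} {p q : ℂ[X]} (hp : α.IsPhaseOf p)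
    (hq : β.IsPhaseOf q) (hγ : γ.IsPhaseOf (p + q))
    (h1 : α.val < β.val + 1) (h2 : β.val < α.val + 1)
    (h3 : γ.val < α.val + 1) (h4 : α.val < γ.val + 1) :
    (α.val < γ.val ∧ γ.val < β.val) ∨ (α.val = γ.val ∧ γ.val = β.val) ∨
      (β.val < γ.val ∧ γ.val < α.val) := by
  rcases lt_trichotomy α.val β.val with h | h | h
  · obtain ⟨χ, hχ, -, -, h5⟩ := hp.exists_add_of_le hq h.le h2
    obtain ⟨h5, h6⟩ := h5 h
    obtain rfl := hγ.unique hχ (by linarith) (by linarith)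
    exact Or.inl ⟨h5, h6⟩
  · obtain ⟨χ, hχ, h5, h6, -⟩ := hp.exists_add_of_le hq h.le h2
    obtain rfl := hγ.unique hχ (by linarith) (by linarith)
    exact Or.inr (Or.inl ⟨by linarith, by linarith⟩)
  · rw [add_comm] at hγ
    obtain ⟨χ, hχ, -, -, h5⟩ := hq.exists_add_of_le hp h.le h1
    obtain ⟨h5, h6⟩ := h5 h
    obtain rfl := hγ.unique hχ (by linarith) (by linarith)
    exact Or.inr (Or.inr ⟨h5, h6⟩)

/-- If `|q - p| < sin (π e) |p|` near `+∞`, then the phase of `q` differs from that of `p` by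
less than `e`. -/
theorem IsPhaseOf.exists_of_norm_sub_lt {φ : PolyPhase} {p q : ℂ[X]} (hp : φ.IsPhaseOf p) {e : ℝ}
    (he : 0 < e) (he' : e < 1 / 2)
    (h : ∀ᶠ m : ℝ in atTop, ‖q.eval (m : ℂ) - p.eval (m : ℂ)‖ <
      Real.sin (Real.pi * e) * ‖p.eval (m : ℂ)‖) :
    ∃ χ : PolyPhase, χ.IsPhaseOf q ∧ φ.val - cst e < χ.val ∧ χ.val < φ.val + cst e := by
  have hq : q ≠ 0 := by
    rintro rfl
    obtain ⟨m, hm⟩ := h.exists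
    simp only [Polynomial.eval_zero, zero_sub, norm_neg] at hm
    nlinarith [Real.sin_le_one (Real.pi * e), norm_nonneg (p.eval (m : ℂ))]
  obtain ⟨χ, hχ, h1, h2⟩ := exists_isPhaseOf_mem_Ico hq (φ + (-1 : ℝ))
  have h2' : χ.val < φ.val + cst 1 := by
    rw [val_add, map_neg, map_one] at h2
    rw [map_one]
    linarith
  rw [val_lt_add] at h2'
  rw [val_le, le_iff_fn] at h1
  have key : ∀ᶠ m in atTop, φ.fn m < χ.fn m + e ∧ χ.fn m < φ.fn m + e := by
    filter_upwards [h1, h2', φ.fn_add (-1), isPhaseOf_iff.mp hp, isPhaseOf_iff.mp hχ, h]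
      with m h1 h2 h3 ⟨r, hr, e1⟩ ⟨t, ht, e2⟩ h4
    set k := χ.fn m - φ.fn m with hk
    have hk1 : -1 ≤ k := by linarith
    have hk2 : k < 1 := by linarith
    set s := Real.sin (Real.pi * e) with hs
    have hs1 : s ≤ 1 := Real.sin_le_one _
    set E := Complex.exp (Real.pi * φ.fn m * Complex.I) with hE
    have hEn : ‖E‖ = 1 := by
      rw [hE, ← Complex.ofReal_mul, Complex.norm_exp_ofReal_mul_I]
    have e3 : Complex.exp (Real.pi * χ.fn m * Complex.I) =
        E * Complex.exp ((Real.pi * k : ℝ) * Complex.I) := by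
      rw [hE, ← Complex.exp_add]
      congr 1
      rw [hk]
      push_cast
      ring
    set D : ℂ := t * Complex.exp ((Real.pi * k : ℝ) * Complex.I) - r with hD
    have h5 : ‖D‖ < s * r := by
      have e4 : q.eval (m : ℂ) - p.eval (m : ℂ) = E * D := by
        rw [e1, e2, e3, hD]
        ring
      have e5 : ‖p.eval (m : ℂ)‖ = r := by
        rw [e1, norm_mul, hEn, mul_one, Complex.norm_real, Real.norm_of_nonneg hr.le]
      rwa [e4, norm_mul, hEn, one_mul, e5] at h4
    have hre : D.re = t * Real.cos (Real.pi * k) - r := by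
      rw [hD, Complex.sub_re, Complex.re_ofReal_mul, Complex.exp_ofReal_mul_I_re, Complex.ofReal_re]
    have him : D.im = t * Real.sin (Real.pi * k) := by
      rw [hD, Complex.sub_im, Complex.im_ofReal_mul, Complex.exp_ofReal_mul_I_im, Complex.ofReal_im,
        sub_zero]
    have hcos : 0 < Real.cos (Real.pi * k) := by
      have : -‖D‖ ≤ D.re := (abs_le.mp (Complex.abs_re_le_norm D)).1
      have h6 : 0 < t * Real.cos (Real.pi * k) := by nlinarith
      exact (mul_pos_iff_of_pos_left ht).mp h6
    have hkhalf : |k| < 1 / 2 := by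
      by_contra! hcon
      have : Real.cos (Real.pi * |k|) ≤ 0 := by
        apply Real.cos_nonpos_of_pi_div_two_le_of_le
        · nlinarith [Real.pi_pos]
        · have : |k| ≤ 1 := abs_le.mpr ⟨hk1, hk2.le⟩
          nlinarith [Real.pi_pos]
      rw [← Real.cos_abs, abs_mul, abs_of_pos Real.pi_pos] at hcos
      linarith
    -- the distance from `r` to the ray spanned by `exp (π i k)` is `r * |sin (π k)|`
    have hsin : |Real.sin (Real.pi * k)| < s := by
      have h6 : (r * Real.sin (Real.pi * k)) ^ 2 ≤ ‖D‖ ^ 2 := by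
        rw [← Complex.normSq_eq_norm_sq, Complex.normSq_apply, hre, him]
        have h7 := Real.sin_sq_add_cos_sq (Real.pi * k)
        have h8 : (Real.sin (Real.pi * k) ^ 2 + Real.cos (Real.pi * k) ^ 2 - 1) *
            (t ^ 2 - r ^ 2) = 0 := by
          rw [h7, sub_self, zero_mul]
        linear_combination sq_nonneg (t - r * Real.cos (Real.pi * k)) - h8
      have h7 := abs_le_of_sq_le_sq' h6 (norm_nonneg _)
      have h8 : r * |Real.sin (Real.pi * k)| ≤ ‖D‖ := by
        have h8 := abs_le.mpr h7
        rwa [abs_mul, abs_of_pos hr] at h8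
      nlinarith
    have hlt : |k| < e := by
      by_contra! hcon
      have h6 : s ≤ Real.sin (Real.pi * |k|) :=
        Real.sin_le_sin_of_le_of_le_pi_div_two (by nlinarith [Real.pi_pos])
          (by nlinarith [Real.pi_pos]) (by nlinarith [Real.pi_pos])
      have h7 : Real.sin (Real.pi * |k|) ≤ |Real.sin (Real.pi * k)| := by
        rcases abs_cases k with ⟨h, -⟩ | ⟨h, -⟩ <;> rw [h]
        · exact le_abs_self _
        · rw [mul_neg, Real.sin_neg]
          exact neg_le_abs _
      linarith
    rw [abs_lt] at hlt
    constructor <;> linarith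
  refine ⟨χ, hχ, ?_, ?_⟩
  · rw [sub_lt_iff_lt_add, val_lt_add]
    exact key.mono fun _ h => h.1
  · rw [val_lt_add]
    exact key.mono fun _ h => h.2

end PolyPhase

/-! ### Extensions -/

section Extensions

variable {C : Type u} [Category.{v} C] [HasZeroObject C] [HasShift C ℤ] [Preadditive C]
  [∀ n : ℤ, (shiftFunctor C n).Additive] [Pretriangulated C]

/-- `E` is an extension of `Y` by `X`: there is an exact triangle `X ⟶ E ⟶ Y ⟶ X⟦1⟧`. -/
def IsExt (X E Y : C) : Prop :=
  ∃ (f : X ⟶ E) (g : E ⟶ Y) (h : Y ⟶ X⟦(1 : ℤ)⟧), Triangle.mk f g h ∈ distTriang C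

namespace IsExt

theorem of_dist (T : Triangle C) (hT : T ∈ distTriang C) : IsExt T.obj₁ T.obj₂ T.obj₃ :=
  ⟨T.mor₁, T.mor₂, T.mor₃, hT⟩

theorem congr {X E Y X' E' Y' : C} (h : IsExt X E Y) (e₁ : X ≅ X') (e₂ : E ≅ E') (e₃ : Y ≅ Y') :
    IsExt X' E' Y' := by
  obtain ⟨f, g, h, hT⟩ := h
  refine ⟨e₁.inv ≫ f ≫ e₂.hom, e₂.inv ≫ g ≫ e₃.hom, e₃.inv ≫ h ≫ e₁.hom⟦1⟧', ?_⟩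
  have c₁ : (e₁.inv ≫ f ≫ e₂.hom) ≫ e₂.inv = e₁.inv ≫ f := by simp
  have c₂ : (e₂.inv ≫ g ≫ e₃.hom) ≫ e₃.inv = e₂.inv ≫ g := by simp
  have c₃ : (e₃.inv ≫ h ≫ e₁.hom⟦1⟧') ≫ e₁.inv⟦1⟧' = e₃.inv ≫ h := by
    simp [← Functor.map_comp]
  exact isomorphic_distinguished _ hT _ (Triangle.isoMk _ _ e₁.symm e₂.symm e₃.symm c₁ c₂ c₃)

theorem rot {X E Y : C} (h : IsExt X E Y) : IsExt E Y (X⟦(1 : ℤ)⟧) := by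
  obtain ⟨f, g, h, hT⟩ := h
  exact of_dist _ (rot_of_distTriang _ hT)

theorem invRot {X E Y : C} (h : IsExt X E Y) : IsExt (Y⟦(-1 : ℤ)⟧) X E := by
  obtain ⟨f, g, h, hT⟩ := h
  exact of_dist _ (inv_rot_of_distTriang _ hT)

theorem shift {X E Y : C} (h : IsExt X E Y) (n : ℤ) : IsExt (X⟦n⟧) (E⟦n⟧) (Y⟦n⟧) := by
  obtain ⟨f, g, h, hT⟩ := h
  exact of_dist _ (Triangle.shift_distinguished _ hT n)

theorem of_isZero_right (X : C) {Y : C} (hY : IsZero Y) : IsExt X X Y :=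
  (of_dist _ (contractible_distinguished X)).congr (Iso.refl _) (Iso.refl _)
    ((isZero_zero C).iso hY)

theorem of_isZero_left {X : C} (hX : IsZero X) (Y : C) : IsExt X Y Y :=
  (of_dist _ (contractible_distinguished₁ Y)).congr ((isZero_zero C).iso hX) (Iso.refl _)
    (Iso.refl _)

theorem iso_of_isZero_left {X E Y : C} (h : IsExt X E Y) (hX : IsZero X) : Nonempty (E ≅ Y) := by
  obtain ⟨f, g, h, hT⟩ := h
  have : IsIso g := (Triangle.isZero₁_iff_isIso₂ _ hT).mp hX
  exact ⟨asIso g⟩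

theorem iso_of_isZero_right {X E Y : C} (h : IsExt X E Y) (hY : IsZero Y) :
    Nonempty (X ≅ E) := by
  obtain ⟨f, g, h, hT⟩ := h
  have : IsIso f := (Triangle.isZero₃_iff_isIso₁ _ hT).mp hY
  exact ⟨asIso f⟩

/-- Quotients of quotients: for `X' ⊆ X ⊆ E`, the quotient `E/X'` is an extension of `E/X`
by `X/X'`. -/
theorem assoc_left [IsTriangulated C] {X E Y X' Z : C} (h : IsExt X E Y) (h' : IsExt X' X Z) :
    ∃ Y', IsExt X' E Y' ∧ IsExt Z Y' Y := by
  obtain ⟨f, g, k, hT⟩ := h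
  obtain ⟨f', g', k', hT'⟩ := h'
  obtain ⟨Y', g'', k'', hT''⟩ := distinguished_cocone_triangle (f' ≫ f)
  exact ⟨Y', ⟨_, _, _, hT''⟩, _, _, _, (Triangulated.someOctahedron rfl hT' hT hT'').mem⟩

/-- Preimages of subobjects of quotients: for `Z ⊆ Y = E/X`, the preimage `X'` of `Z` in `E` is
an extension of `Z` by `X`. -/
theorem assoc_right [IsTriangulated C] {X E Y Z Y' : C} (h : IsExt X E Y) (h' : IsExt Z Y Y') :
    ∃ X', IsExt X' E Y' ∧ IsExt X X' Z := by
  obtain ⟨f, g, k, hT⟩ := h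
  obtain ⟨f', g', k', hT'⟩ := h'
  obtain ⟨X', f'', k'', hT''⟩ := distinguished_cocone_triangle₁ (g ≫ g')
  exact ⟨X', ⟨_, _, _, hT''⟩, _, _, _, (Triangulated.someOctahedron' rfl hT hT' hT'').mem⟩

/-- If the map `X ⟶ E` vanishes and so does every map `X ⟶ Y⟦-1⟧`, then `X = 0`. -/
theorem isZero_left_of_hom {X E Y : C} (h : IsExt X E Y) (h₁ : ∀ f : X ⟶ E, f = 0)
    (h₂ : ∀ f : X ⟶ Y⟦(-1 : ℤ)⟧, f = 0) : IsZero X := by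
  obtain ⟨f, g, k, hT⟩ := h.invRot
  obtain ⟨u, hu⟩ := Triangle.coyoneda_exact₂ _ hT (𝟙 X) (h₁ _)
  rw [IsZero.iff_id_eq_zero, hu]
  exact (h₂ u) ▸ zero_comp

/-- If the map `E ⟶ Y` vanishes and so does every map `X⟦1⟧ ⟶ Y`, then `Y = 0`. -/
theorem isZero_right_of_hom {X E Y : C} (h : IsExt X E Y) (h₁ : ∀ f : E ⟶ Y, f = 0)
    (h₂ : ∀ f : X⟦(1 : ℤ)⟧ ⟶ Y, f = 0) : IsZero Y := by
  obtain ⟨f, g, k, hT⟩ := h.rot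
  obtain ⟨u, hu⟩ := Triangle.yoneda_exact₂ _ hT (𝟙 Y) (h₁ _)
  rw [IsZero.iff_id_eq_zero, hu]
  exact (h₂ u) ▸ comp_zero

theorem hom_to_mid {X E Y A : C} (h : IsExt X E Y) (h₁ : ∀ f : A ⟶ X, f = 0)
    (h₂ : ∀ f : A ⟶ Y, f = 0) (f : A ⟶ E) : f = 0 := by
  obtain ⟨a, b, c, hT⟩ := h
  obtain ⟨u, rfl⟩ := Triangle.coyoneda_exact₂ _ hT f (h₂ _)
  exact (h₁ u) ▸ zero_comp

theorem hom_from_mid {X E Y A : C} (h : IsExt X E Y) (h₁ : ∀ f : X ⟶ A, f = 0)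
    (h₂ : ∀ f : Y ⟶ A, f = 0) (f : E ⟶ A) : f = 0 := by
  obtain ⟨a, b, c, hT⟩ := h
  obtain ⟨u, rfl⟩ := Triangle.yoneda_exact₂ _ hT f (h₁ _)
  exact (h₂ u) ▸ comp_zero

theorem k0Class_eq {X E Y : C} (h : IsExt X E Y) : k0Class E = k0Class X + k0Class Y := by
  obtain ⟨f, g, k, hT⟩ := h
  have : (QuotientAddGroup.mk (FreeAbelianGroup.of E - (FreeAbelianGroup.of X +
      FreeAbelianGroup.of Y)) : TriangulatedK0 C) = 0 := by
    rw [QuotientAddGroup.eq_zero_iff]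
    exact AddSubgroup.subset_closure ⟨_, hT, rfl⟩
  rw [QuotientAddGroup.mk_sub, sub_eq_zero] at this
  exact this

end IsExt

theorem k0Class_eq_zero {X : C} (hX : IsZero X) : k0Class X = 0 := by
  have := (IsExt.of_isZero_right X hX).k0Class_eq
  simpa using this

theorem k0Class_congr {X Y : C} (e : X ≅ Y) : k0Class X = k0Class Y := by
  have h := ((IsExt.of_isZero_right X (isZero_zero C)).congr (Iso.refl _) e
    (Iso.refl _)).k0Class_eq
  rw [k0Class_eq_zero (isZero_zero C), add_zero] at h
  exact h.symm

namespace ExtensionClosure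

variable {P Q : ObjectProperty C}

theorem isExt {X E Y : C} (h : IsExt X E Y) (hX : ExtensionClosure P X)
    (hY : ExtensionClosure P Y) : ExtensionClosure P E := by
  obtain ⟨f, g, k, hT⟩ := h
  exact .ext _ hT hX hY

theorem bind {E : C} (hE : ExtensionClosure P E) (h : ∀ E, P E → ExtensionClosure Q E) :
    ExtensionClosure Q E := by
  induction hE with
  | of E hE => exact h E hE
  | ext T hT _ _ h₁ h₃ => exact .ext T hT h₁ h₃

theorem mono {E : C} (hE : ExtensionClosure P E) (h : ∀ E, P E → Q E) : ExtensionClosure Q E :=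
  hE.bind fun E hE => .of E (h E hE)

theorem congr {E E' : C} (hE : ExtensionClosure P E) (e : E ≅ E')
    (h : ∀ X Y : C, (X ≅ Y) → P X → P Y) : ExtensionClosure P E' := by
  induction hE with
  | of E hE => exact .of _ (h _ _ e hE)
  | ext T hT k₁ k₃ =>
    exact isExt ((IsExt.of_dist T hT).congr (Iso.refl _) e (Iso.refl _)) k₁ k₃

theorem hom_eq_zero {X Y : C} (hX : ExtensionClosure P X) (hY : ExtensionClosure Q Y)
    (h : ∀ A B : C, P A → Q B → ∀ f : A ⟶ B, f = 0) (f : X ⟶ Y) : f = 0 := by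
  induction hX with
  | of A hA =>
    induction hY with
    | of B hB => exact h A B hA hB f
    | ext T hT _ _ h₁ h₃ => exact (IsExt.of_dist T hT).hom_to_mid h₁ h₃ f
  | ext T hT _ _ h₁ h₃ => exact (IsExt.of_dist T hT).hom_from_mid h₁ h₃ f

theorem shift {E : C} (hE : ExtensionClosure P E) (n : ℤ)
    (h : ∀ E, P E → ExtensionClosure Q (E⟦n⟧)) : ExtensionClosure Q (E⟦n⟧) := by
  induction hE with
  | of E hE => exact h E hE
  | ext T hT _ _ h₁ h₃ => exact isExt ((IsExt.of_dist T hT).shift n) h₁ h₃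

end ExtensionClosure

/-! ### Subcategories of a slicing cut out by bounds on the phases -/

/-- `HasHN P t E`: the object `E` is zero, or has a Harder-Narasimhan filtration all of whose
phases are greater than `t`. -/
inductive HasHN (P : PolyPhase → ObjectProperty C) : PhaseField → C → Prop
  | zero (t : PhaseField) (E : C) (hE : IsZero E) : HasHN P t E
  | snoc (t : PhaseField) (φ : PolyPhase) (K E B : C) (ht : t < φ.val) (hK : HasHN P φ.val K)
    (hB : P φ B) (hB' : ¬ IsZero B) (h : IsExt K E B) : HasHN P t E

theorem HNFiltration.hasHN {P : PolyPhase → ObjectProperty C} {X : C} (F : HNFiltration P X)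
    {t : PhaseField} (ht : t < (F.phase (Fin.last F.n)).val) : HasHN P t X := by
  have key : ∀ (i : Fin (F.n + 2)) (t : PhaseField),
      (∀ j : Fin (F.n + 1), j.castSucc < i → t < (F.phase j).val) → HasHN P t (F.E i) := by
    intro i
    induction i using Fin.induction with
    | zero => exact fun t _ => .zero _ _ F.isZero_bot
    | succ i ih =>
      intro t ht
      refine .snoc t (F.phase i) (F.E i.castSucc) _ (F.A i) (ht i Fin.castSucc_lt_succ)
        (ih _ fun j hj => ?_) (F.semistable i) (F.nonzero i) ⟨_, _, _, F.distinguished i⟩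
      rw [PolyPhase.val_lt]
      exact F.phase_anti (by simpa using hj)
  have := key (Fin.last _) t fun j _ => by
    refine ht.trans_le (PolyPhase.val_le.mpr (F.phase_anti.antitone (Fin.le_last j)))
  cases this with
  | zero _ _ hE => exact .zero _ _ (hE.of_iso F.isoTop.symm)
  | snoc _ φ K _ B h1 h2 h3 h4 h5 =>
    exact .snoc _ φ K _ B h1 h2 h3 h4 (h5.congr (Iso.refl _) F.isoTop (Iso.refl _))

namespace PolySlicing

variable (s : PolySlicing C)

theorem P_congr {φ : PolyPhase} {X Y : C} (e : X ≅ Y) (h : s.P φ X) : s.P φ Y :=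
  (s.closedIso φ).of_iso e h

theorem P_of_isZero {φ : PolyPhase} {X : C} (h : IsZero X) : s.P φ X := by
  obtain ⟨Z, hZ, hP⟩ := (s.containsZero φ).exists_zero
  exact s.P_congr (hZ.iso h) hP

theorem P_shift_neg {φ : PolyPhase} {X : C} (h : s.P φ X) :
    s.P (φ + (-1 : ℝ)) (X⟦(-1 : ℤ)⟧) := by
  rw [← s.shift, PolyPhase.add_add, neg_add_cancel, PolyPhase.add_zero']
  exact s.P_congr (shiftNegShift X (1 : ℤ)).symm h

/-- The extension-closed subcategory generated by the zero objects and the `P φ` such that `φ`,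
seen in `PhaseField`, satisfies `p`. It is mostly used for intervals `p` with end points
in `PhaseField`. -/
def In (p : PhaseField → Prop) : ObjectProperty C :=
  ExtensionClosure fun E => IsZero E ∨ ∃ φ : PolyPhase, p φ.val ∧ s.P φ E

variable {s} {p q r : PhaseField → Prop}

theorem In.of_isZero {E : C} (h : IsZero E) : s.In p E := .of _ (Or.inl h)

theorem In.of_P {φ : PolyPhase} {E : C} (h : s.P φ E) (hφ : p φ.val) : s.In p E :=
  .of _ (Or.inr ⟨φ, hφ, h⟩)

theorem In.mono {E : C} (h : s.In p E) (hpq : ∀ z, p z → q z) : s.In q E :=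
  ExtensionClosure.mono h fun _ => Or.imp_right fun ⟨φ, hφ, h⟩ => ⟨φ, hpq _ hφ, h⟩

theorem In.congr {E E' : C} (h : s.In p E) (e : E ≅ E') : s.In p E' := by
  refine ExtensionClosure.congr h e fun X Y e h => ?_
  rcases h with h | ⟨φ, hφ, h⟩
  · exact Or.inl (h.of_iso e.symm)
  · exact Or.inr ⟨φ, hφ, s.P_congr e h⟩

theorem In.mid {X E Y : C} (h : IsExt X E Y) (hX : s.In p X) (hY : s.In p Y) : s.In p E :=
  ExtensionClosure.isExt h hX hY

theorem In.shift_one {E : C} (h : s.In p E) (hpq : ∀ z, p z → q (z + 1)) :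
    s.In q (E⟦(1 : ℤ)⟧) := by
  refine ExtensionClosure.shift h 1 fun E h => ?_
  rcases h with h | ⟨φ, hφ, h⟩
  · exact In.of_isZero (Functor.map_isZero _ h)
  · refine In.of_P ((s.shift φ E).mpr h) ?_
    rw [PolyPhase.val_add_one]
    exact hpq _ hφ

theorem In.shift_neg_one {E : C} (h : s.In p E) (hpq : ∀ z, p z → q (z - 1)) :
    s.In q (E⟦(-1 : ℤ)⟧) := by
  refine ExtensionClosure.shift h (-1) fun E h => ?_
  rcases h with h | ⟨φ, hφ, h⟩
  · exact In.of_isZero (Functor.map_isZero _ h)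
  · refine In.of_P (s.P_shift_neg h) ?_
    rw [PolyPhase.val_add, map_neg, map_one, ← sub_eq_add_neg]
    exact hpq _ hφ

theorem In.left {X E Y : C} (h : IsExt X E Y) (hE : s.In p E) (hY : s.In q Y)
    (hpq : ∀ z, q z → p (z - 1)) : s.In p X :=
  In.mid h.invRot (hY.shift_neg_one hpq) hE

theorem In.right {X E Y : C} (h : IsExt X E Y) (hE : s.In p E) (hX : s.In q X)
    (hpq : ∀ z, q z → p (z + 1)) : s.In p Y :=
  In.mid h.rot hE (hX.shift_one hpq)

theorem In.hom_eq_zero {X Y : C} (hX : s.In p X) (hY : s.In q Y)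
    (hpq : ∀ z w, p z → q w → w < z) (f : X ⟶ Y) : f = 0 := by
  refine ExtensionClosure.hom_eq_zero hX hY (fun A B hA hB f => ?_) f
  rcases hA with hA | ⟨φ, hφ, hA⟩
  · exact hA.eq_of_src _ _
  rcases hB with hB | ⟨ψ, hψ, hB⟩
  · exact hB.eq_of_tgt _ _
  exact s.hom_eq_zero φ ψ (PolyPhase.val_lt.mp (hpq _ _ hφ hψ)) A B hA hB f

variable (s) in
theorem exists_hasHN (E : C) : ∃ t, HasHN s.P t E := by
  by_cases hE : IsZero E
  · exact ⟨0, .zero _ _ hE⟩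
  · obtain ⟨F⟩ := s.exists_hn E hE
    exact ⟨_, F.hasHN (sub_one_lt _)⟩

theorem In.of_hasHN {t : PhaseField} {E : C} (h : HasHN s.P t E) : s.In (t < ·) E := by
  induction h with
  | zero t E hE => exact In.of_isZero hE
  | snoc t φ K E B ht hK hB hB' h ih =>
    exact In.mid h (ih.mono fun z hz => ht.trans hz) (In.of_P hB ht)

section Truncation

variable [IsTriangulated C]

theorem exists_truncation_of_hasHN {t : PhaseField} {E : C} (h : HasHN s.P t E)
    (hp : ∀ z w, p z → z < w → p w) :
    ∃ X Y, IsExt X E Y ∧ s.In (fun z => p z ∧ t < z) X ∧ s.In (fun z => ¬ p z ∧ t < z) Y := by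
  induction h with
  | zero t E hE =>
    exact ⟨E, E, .of_isZero_right E hE, In.of_isZero hE, In.of_isZero hE⟩
  | snoc t φ K E B ht hK hB hB' h ih =>
    by_cases hφ : p φ.val
    · refine ⟨E, 0, .of_isZero_right E (isZero_zero C), ?_, In.of_isZero (isZero_zero C)⟩
      refine In.mid h ((In.of_hasHN hK).mono fun z hz => ?_) (In.of_P hB ⟨hφ, ht⟩)
      exact ⟨hp _ _ hφ hz, ht.trans hz⟩
    · obtain ⟨X, Y, h1, h2, h3⟩ := ih
      obtain ⟨Y', h4, h5⟩ := h.assoc_left h1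
      refine ⟨X, Y', h4, h2.mono fun z hz => ⟨hz.1, ht.trans hz.2⟩, ?_⟩
      exact In.mid h5 (h3.mono fun z hz => ⟨hz.1, ht.trans hz.2⟩) (In.of_P hB ⟨hφ, ht⟩)

variable (s) in
/-- Truncation of an object with respect to an upper set `p` of phases. -/
theorem exists_truncation (E : C) (hp : ∀ z w, p z → z < w → p w) :
    ∃ X Y, IsExt X E Y ∧ s.In p X ∧ s.In (fun z => ¬ p z) Y := by
  obtain ⟨t, ht⟩ := s.exists_hasHN E
  obtain ⟨X, Y, h1, h2, h3⟩ := exists_truncation_of_hasHN ht hp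
  exact ⟨X, Y, h1, h2.mono fun _ h => h.1, h3.mono fun _ h => h.1⟩

/-- The truncations of an object of `In p`, for `p` an upper set, stay in `In p`. -/
theorem In.exists_truncation {E : C} (hE : s.In p E) (hp : ∀ z w, p z → z < w → p w)
    (hr : ∀ z w, r z → z < w → r w) :
    ∃ X Y, IsExt X E Y ∧ s.In (fun z => r z ∧ p z) X ∧ s.In (fun z => ¬ r z ∧ p z) Y := by
  obtain ⟨t, ht⟩ := s.exists_hasHN E
  cases ht with
  | zero _ _ hE =>
    exact ⟨E, E, .of_isZero_right E hE, In.of_isZero hE, In.of_isZero hE⟩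
  | snoc _ φ K _ B ht hK hB hB' h =>
    have hφ : p φ.val := by
      by_contra hφ
      -- otherwise the nonzero quotient `B` of `E` would receive no map from `E`
      have hB1 : s.In (fun z => ¬ p z ∧ z ≤ φ.val) B := In.of_P hB ⟨hφ, le_rfl⟩
      refine hB' (h.isZero_right_of_hom (fun f => ?_) fun f => ?_)
      · refine hE.hom_eq_zero hB1 (fun z w hz hw => ?_) f
        by_contra! hzw
        rcases hzw.eq_or_lt with rfl | hzw
        · exact hw.1 hz
        · exact hw.1 (hp _ _ hz hzw)
      · refine ((In.of_hasHN hK).shift_one (q := fun z => φ.val < z) fun z hz => ?_).hom_eq_zero hB1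
          (fun z w hz hw => hw.2.trans_lt hz) f
        linarith
    obtain ⟨X, Y, h1, h2, h3⟩ := exists_truncation_of_hasHN hK hr
    by_cases hrφ : r φ.val
    · refine ⟨E, 0, .of_isZero_right E (isZero_zero C), ?_, In.of_isZero (isZero_zero C)⟩
      refine In.mid h ((In.of_hasHN hK).mono fun z hz => ?_) (In.of_P hB ⟨hrφ, hφ⟩)
      exact ⟨hr _ _ hrφ hz, hp _ _ hφ hz⟩
    · obtain ⟨Y', h4, h5⟩ := h.assoc_left h1
      refine ⟨X, Y', h4, h2.mono fun z hz => ⟨hz.1, hp _ _ hφ hz.2⟩, ?_⟩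
      exact In.mid h5 (h3.mono fun z hz => ⟨hz.1, hp _ _ hφ hz.2⟩) (In.of_P hB ⟨hrφ, hφ⟩)

/-- An object whose phases are bounded below by `p` and bounded above by `q` has all its phases
in the intersection. -/
theorem In.and {E : C} (hE : s.In p E) (hE' : s.In q E) (hp : ∀ z w, p z → z < w → p w)
    (hq : ∀ z w, q w → z < w → q z) : s.In (fun z => p z ∧ q z) E := by
  obtain ⟨X, Y, h1, h2, h3⟩ := hE.exists_truncation (r := fun z => ¬ q z) hp
    fun z w hz hzw hw => hz (hq _ _ hw hzw)
  have hlt : ∀ z w, (¬ q z ∧ p z) → q w → w < z := by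
    intro z w hz hw
    by_contra! hzw
    rcases hzw.eq_or_lt with rfl | hzw
    · exact hz.1 hw
    · exact hz.1 (hq _ _ hw hzw)
  have hX : IsZero X := by
    refine h1.isZero_left_of_hom (fun f => h2.hom_eq_zero hE' hlt f) fun f => ?_
    refine h2.hom_eq_zero (h3.shift_neg_one (q := q) fun z hz => ?_) hlt f
    exact hq _ _ (not_not.mp hz.1) (by linarith)
  obtain ⟨e⟩ := h1.iso_of_isZero_left hX
  exact (h3.congr e.symm).mono fun z hz => ⟨hz.2, not_not.mp hz.1⟩

end Truncation

end PolySlicing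

end Extensions

/-! ### Finite length in terms of triangles -/

section FiniteLength

variable {C : Type u} [Category.{v} C] [HasZeroObject C] [HasShift C ℤ] [Preadditive C]
  [∀ n : ℤ, (shiftFunctor C n).Additive] [Pretriangulated C]

namespace PolySlicing

variable (s : PolySlicing C)

/-- The open interval with end points `a` and `b`, as a predicate. -/
abbrev openIvl (a b : PhaseField) : PhaseField → Prop := fun z => a < z ∧ z < b

/-- `X'` is a proper strict subobject of `X` in `In p`, with the quotient recorded by a
triangle. -/
def StrictSub (p : PhaseField → Prop) (X' X : C) : Prop :=
  ∃ Z, IsExt X' X Z ∧ s.In p X' ∧ s.In p X ∧ s.In p Z ∧ ¬ IsZero Z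

/-- `Y'` is a proper strict quotient of `Y` in `In p`, with the kernel recorded by a triangle. -/
def StrictQuot (p : PhaseField → Prop) (Y' Y : C) : Prop :=
  ∃ Z, IsExt Z Y Y' ∧ s.In p Z ∧ s.In p Y ∧ s.In p Y' ∧ ¬ IsZero Z

/-- `In p` is artinian and noetherian with respect to subobjects and quotients given by
triangles. -/
def FiniteLength (p : PhaseField → Prop) : Prop :=
  ∀ E, s.In p E → Acc (s.StrictSub p) E ∧ Acc (s.StrictQuot p) E

variable {s}

theorem FiniteLength.of_imp {t : PolySlicing C} {p q : PhaseField → Prop} (h : s.FiniteLength q)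
    (hpq : ∀ E, t.In p E → s.In q E) : t.FiniteLength p := by
  intro E hE
  obtain ⟨h1, h2⟩ := h E (hpq E hE)
  constructor
  · refine Subrelation.accessible ?_ h1
    rintro X' X ⟨Z, h1, h2, h3, h4, h5⟩
    exact ⟨Z, h1, hpq _ h2, hpq _ h3, hpq _ h4, h5⟩
  · refine Subrelation.accessible ?_ h2
    rintro X' X ⟨Z, h1, h2, h3, h4, h5⟩
    exact ⟨Z, h1, hpq _ h2, hpq _ h3, hpq _ h4, h5⟩

theorem In.gt {a b : PhaseField} {E : C} (h : s.In (openIvl a b) E) : s.In (a < ·) E :=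
  h.mono fun _ h => h.1

theorem In.lt {a b : PhaseField} {E : C} (h : s.In (openIvl a b) E) : s.In (· < b) E :=
  h.mono fun _ h => h.2

theorem In.ivl [IsTriangulated C] {a b : PhaseField} {E : C} (h : s.In (a < ·) E)
    (h' : s.In (· < b) E) : s.In (openIvl a b) E :=
  h.and h' (fun _ _ h1 h2 => h1.trans h2) fun _ _ h1 h2 => h2.trans h1

section

variable {a b : PhaseField} {A : ObjectProperty C}

/-- The morphism `i` of `A` is the first morphism of a triangle whose third vertex also lies in
the interval from `a` to `b`. -/
def TriMono (s : PolySlicing C) (a b : PhaseField) {X E : A.FullSubcategory} (i : X ⟶ E) : Prop :=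
  ∃ (Y : C) (v : E.obj ⟶ Y) (w : Y ⟶ X.obj⟦(1 : ℤ)⟧),
    Triangle.mk i.hom v w ∈ distTriang C ∧ s.In (openIvl a b) Y

theorem TriMono.precomp_iso {X' X E : A.FullSubcategory} {i : X ⟶ E} (h : TriMono s a b i)
    (e : X' ≅ X) : TriMono s a b (e.hom ≫ i) := by
  obtain ⟨Y, v, w, hT, hY⟩ := h
  refine ⟨Y, v, w ≫ e.inv.hom⟦1⟧', isomorphic_distinguished _ hT _
    (Triangle.isoMk _ _ (A.ι.mapIso e) (Iso.refl _) (Iso.refl _) ?_ ?_ ?_), hY⟩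
  · change (e.hom.hom ≫ i.hom) ≫ 𝟙 _ = e.hom.hom ≫ i.hom
    simp
  · change v ≫ 𝟙 _ = 𝟙 _ ≫ v
    simp
  · change (w ≫ e.inv.hom⟦1⟧') ≫ e.hom.hom⟦1⟧' = 𝟙 _ ≫ w
    rw [Category.assoc, ← Functor.map_comp]
    simp

variable (hA : ∀ E, A E ↔ s.In (openIvl a b) E) (hba : b ≤ a + 1)
include hA hba

theorem TriMono.mono {X E : A.FullSubcategory} {i : X ⟶ E} (h : TriMono s a b i) : Mono i := by
  obtain ⟨Y, v, w, hT, hY⟩ := h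
  refine Preadditive.mono_of_cancel_zero _ fun {T} u hu => ?_
  have hu' : u.hom ≫ i.hom = 0 := congrArg InducedCategory.Hom.hom hu
  obtain ⟨k, hk⟩ := Triangle.coyoneda_exact₂ _ (inv_rot_of_distTriang _ hT) u.hom hu'
  have hk0 : k = 0 := ((hA _).mp T.property).hom_eq_zero
    (hY.shift_neg_one (q := (· < b - 1)) fun z hz => by linarith [hz.2])
    (fun z w hz hw => by linarith [hz.1]) k
  ext
  rw [hk, hk0]
  exact zero_comp

theorem TriMono.normalMono {X E : A.FullSubcategory} {i : X ⟶ E} (h : TriMono s a b i) :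
    Nonempty (NormalMono i) := by
  have hm : Mono i := h.mono hA hba
  obtain ⟨Y, v, w, hT, hY⟩ := h
  have key : ∀ (T : A.FullSubcategory) (k : T ⟶ E),
      k ≫ (ObjectProperty.homMk v : E ⟶ ⟨Y, (hA _).mpr hY⟩) = 0 → ∃ l : T ⟶ X, l ≫ i = k := by
    intro T k hk
    have hk' : k.hom ≫ v = 0 := congrArg InducedCategory.Hom.hom hk
    obtain ⟨l, hl⟩ := Triangle.coyoneda_exact₂ _ hT k.hom hk'
    exact ⟨ObjectProperty.homMk l, by ext; exact hl.symm⟩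
  refine ⟨⟨⟨Y, (hA _).mpr hY⟩, ObjectProperty.homMk v, ?_, ?_⟩⟩
  · ext
    exact comp_distTriang_mor_zero₁₂ _ hT
  · exact KernelFork.IsLimit.ofι _ _ (fun k hk => (key _ k hk).choose)
      (fun k hk => (key _ k hk).choose_spec)
      (fun k hk m hm' => (cancel_mono i).mp (by rw [hm', (key _ k hk).choose_spec]))

variable [IsTriangulated C]

/-- The kernel of `g : X ⟶ Y` in an interval of length at most `1` is the truncation of the
fibre of `g`, so that its cokernel stays in the interval. -/
theorem NormalMono.triMono {K X : A.FullSubcategory} {i : K ⟶ X}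
    (hi : NormalMono i) (hab : a < b) : TriMono s a b i := by
  obtain ⟨Y, g, w, hlim⟩ := hi
  have hX := (hA _).mp X.property
  have hY := (hA _).mp Y.property
  have hK := (hA _).mp K.property
  obtain ⟨N, n, n', hN⟩ := distinguished_cocone_triangle₁ g.hom
  obtain ⟨K', M, ⟨k, m, m', hM⟩, hK'1, hM1⟩ := s.exists_truncation N (p := (a < ·))
    fun _ _ h1 h2 => h1.trans h2
  obtain ⟨D, d, d', hD⟩ := distinguished_cocone_triangle (k ≫ n)
  have hMDY : IsExt M D Y.obj := ⟨_, _, _, (Triangulated.someOctahedron rfl hM hN hD).mem⟩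
  have hNb : s.In (· < b) N := In.left ⟨_, _, _, hN⟩ hX.lt hY.lt fun z hz => by linarith
  have hMb : s.In (· < b) M := hM1.mono fun z hz => (not_lt.mp hz).trans_lt hab
  have hKK' : s.In (openIvl a b) K' :=
    In.ivl hK'1 (In.left ⟨_, _, _, hM⟩ hNb hMb fun z hz => by linarith)
  have hDD : s.In (openIvl a b) D := In.ivl
    (In.right ⟨_, _, _, hD⟩ hX.gt hK'1 fun z hz => by linarith) (In.mid hMDY hMb hY.lt)
  let K'' : A.FullSubcategory := ⟨K', (hA _).mpr hKK'⟩
  let i' : K'' ⟶ X := ObjectProperty.homMk (k ≫ n)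
  have hi' : TriMono s a b i' := ⟨D, d, d', hD, hDD⟩
  have hm' : Mono i' := hi'.mono hA hba
  have hig : i.hom ≫ g.hom = 0 := congrArg InducedCategory.Hom.hom w
  obtain ⟨x, hx⟩ := Triangle.coyoneda_exact₂ _ hN i.hom hig
  have hxm : x ≫ m = 0 := hK.gt.hom_eq_zero hM1
    (fun z w hz hw => (not_lt.mp hw).trans_lt hz) _
  obtain ⟨y, hy⟩ := Triangle.coyoneda_exact₂ _ hM x hxm
  have hyi : (ObjectProperty.homMk y : K ⟶ K'') ≫ i' = i := by
    ext
    change y ≫ k ≫ n = i.hom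
    rw [hx, hy]
    exact (Category.assoc _ _ _).symm
  have hi'g : i' ≫ g = 0 := by
    ext
    change (k ≫ n) ≫ g.hom = 0
    rw [Category.assoc]
    exact (comp_distTriang_mor_zero₁₂ _ hN) ▸ comp_zero
  obtain ⟨z, hz⟩ := KernelFork.IsLimit.lift' hlim i' hi'g
  change z ≫ i = i' at hz
  have hm : Mono i := mono_of_isLimit_fork hlim
  let e : K ≅ K'' := ⟨ObjectProperty.homMk y, z,
    (cancel_mono i).mp (by rw [Category.assoc, hz, hyi, Category.id_comp]),
    (cancel_mono i').mp (by rw [Category.assoc, hyi, hz, Category.id_comp])⟩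
  have := hi'.precomp_iso e
  rwa [show e.hom ≫ i' = i from hyi] at this

theorem finiteLength_of_isOfFiniteLength (h : IsOfFiniteLength A.FullSubcategory) :
    s.FiniteLength (openIvl a b) := by
  intro E' hE'
  set E : A.FullSubcategory := ⟨E', (hA _).mpr hE'⟩ with hE
  obtain ⟨hlt, hgt⟩ := h E
  have mk : ∀ {X : A.FullSubcategory} (i : X ⟶ E) (hi : TriMono s a b i) [Mono i],
      Nonempty (NormalMono (Subobject.mk i).arrow) := by
    intro X i hi _
    have := (hi.precomp_iso (Subobject.underlyingIso i)).normalMono hA hba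
    rwa [Subobject.underlyingIso_hom_comp_eq_mk] at this
  constructor
  · have key : ∀ (S : StrictSubobject E) (X : A.FullSubcategory) (i : X ⟶ E)
        (_ : TriMono s a b i) (_ : Mono i), Subobject.mk i = S.1 →
        Acc (s.StrictSub (openIvl a b)) X.obj := by
      intro S
      induction S using hlt.wf.induction with
      | _ S ih =>
        intro X i hi him hS
        refine ⟨_, ?_⟩
        rintro X' ⟨Z, ⟨j, z, z', hj⟩, hX', hX, hZ, hZ0⟩
        let X'' : A.FullSubcategory := ⟨X', (hA _).mpr hX'⟩
        let j' : X'' ⟶ X := ObjectProperty.homMk j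
        have hj' : TriMono s a b j' := ⟨Z, z, z', hj, hZ⟩
        have hjm : Mono j' := hj'.mono hA hba
        have hjiso : ¬ IsIso j' := by
          intro hiso
          have : IsIso j := inferInstanceAs (IsIso j'.hom)
          exact hZ0 (Triangle.isZero₃_of_isIso₁ _ hj this)
        obtain ⟨Y, v, w, hT, hY⟩ := hi
        obtain ⟨D, d, d', hD⟩ := distinguished_cocone_triangle (j ≫ i.hom)
        have hZD : IsExt Z D Y := ⟨_, _, _, (Triangulated.someOctahedron rfl hj hT hD).mem⟩
        have hji : TriMono s a b (j' ≫ i) := ⟨D, d, d', hD, In.mid hZD hZ hY⟩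
        refine ih ⟨Subobject.mk (j' ≫ i), mk _ hji⟩ ?_ X'' (j' ≫ i) hji inferInstance rfl
        change Subobject.mk (j' ≫ i) < S.1
        rw [← hS]
        exact Subobject.mk_lt_mk_of_comm j' rfl hjiso
    have h1 : TriMono s a b (𝟙 E) :=
      ⟨0, 0, 0, contractible_distinguished E', In.of_isZero (isZero_zero C)⟩
    exact key ⟨Subobject.mk (𝟙 E), mk _ h1⟩ E (𝟙 E) h1 inferInstance rfl
  · have key : ∀ (S : StrictSubobject E) (X : A.FullSubcategory) (i : X ⟶ E) (_ : Mono i) (Y : C)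
        (v : E' ⟶ Y) (w : Y ⟶ X.obj⟦(1 : ℤ)⟧), Triangle.mk i.hom v w ∈ distTriang C →
        s.In (openIvl a b) Y → Subobject.mk i = S.1 →
        Acc (s.StrictQuot (openIvl a b)) Y := by
      intro S
      induction S using hgt.wf.induction with
      | _ S ih =>
        intro X i him Y v w hT hY hS
        refine ⟨_, ?_⟩
        rintro Y' ⟨Z, ⟨z, y, y', hy⟩, hZ, -, hY', hZ0⟩
        obtain ⟨X', x, x', hx⟩ := distinguished_cocone_triangle₁ (v ≫ y)
        let o := Triangulated.someOctahedron' rfl hT hy hx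
        have hX' : s.In (openIvl a b) X' :=
          In.mid ⟨_, _, _, o.mem⟩ ((hA _).mp X.property) hZ
        let X'' : A.FullSubcategory := ⟨X', (hA _).mpr hX'⟩
        let i' : X'' ⟶ E := ObjectProperty.homMk x
        have hi' : TriMono s a b i' := ⟨Y', _, _, hx, hY'⟩
        have him' : Mono i' := hi'.mono hA hba
        let j : X ⟶ X'' := ObjectProperty.homMk o.m₁
        have hj : j ≫ i' = i := by
          ext
          exact o.comm₁
        have hjiso : ¬ IsIso j := by
          intro hiso
          have : IsIso o.m₁ := inferInstanceAs (IsIso j.hom)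
          exact hZ0 (Triangle.isZero₃_of_isIso₁ _ o.mem this)
        refine ih ⟨Subobject.mk i', mk _ hi'⟩ ?_ X'' i' him' Y' _ _ hx hY' rfl
        change S.1 < Subobject.mk i'
        rw [← hS]
        exact Subobject.mk_lt_mk_of_comm j hj hjiso
    let O : A.FullSubcategory := ⟨0, (hA _).mpr (In.of_isZero (isZero_zero C))⟩
    let i : O ⟶ E := ObjectProperty.homMk 0
    have hd : Triangle.mk i.hom (𝟙 E') 0 ∈ distTriang C := contractible_distinguished₁ E'
    have hi : TriMono s a b i := ⟨E', 𝟙 E', 0, hd, hE'⟩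
    exact key ⟨@Subobject.mk _ _ _ _ i (hi.mono hA hba), @mk _ i hi (hi.mono hA hba)⟩ O i
      (hi.mono hA hba) E' _ _ hd hE' rfl

theorem FiniteLength.isOfFiniteLength (h : s.FiniteLength (openIvl a b)) (hab : a < b) :
    IsOfFiniteLength A.FullSubcategory := by
  intro E
  -- the quotient of two nested strict subobjects
  have key : ∀ S' S : StrictSubobject E, S' < S → ∀ (Y' Y : C) (v' : E.obj ⟶ Y')
      (w' : Y' ⟶ ((S'.1 : A.FullSubcategory)).obj⟦(1 : ℤ)⟧) (v : E.obj ⟶ Y)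
      (w : Y ⟶ ((S.1 : A.FullSubcategory)).obj⟦(1 : ℤ)⟧),
      Triangle.mk S'.1.arrow.hom v' w' ∈ distTriang C → s.In (openIvl a b) Y' →
      Triangle.mk S.1.arrow.hom v w ∈ distTriang C → s.In (openIvl a b) Y →
      ∃ Z, IsExt (S'.1 : A.FullSubcategory).obj (S.1 : A.FullSubcategory).obj Z ∧
        IsExt Z Y' Y ∧ s.In (openIvl a b) Z ∧ ¬ IsZero Z := by
    intro S' S hlt Y' Y v' w' v w hT' hY' hT hY
    have hle : S'.1 ≤ S.1 := hlt.le
    let j := Subobject.ofLE S'.1 S.1 hle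
    have hj : j ≫ S.1.arrow = S'.1.arrow := Subobject.ofLE_arrow hle
    have hj' : j.hom ≫ S.1.arrow.hom = S'.1.arrow.hom := congrArg InducedCategory.Hom.hom hj
    obtain ⟨Z, z, z', hZ⟩ := distinguished_cocone_triangle j.hom
    have h1 : IsExt Z Y' Y := ⟨_, _, _, (Triangulated.someOctahedron hj' hZ hT hT').mem⟩
    have h2 : IsExt (S'.1 : A.FullSubcategory).obj (S.1 : A.FullSubcategory).obj Z :=
      ⟨_, _, _, hZ⟩
    refine ⟨Z, h2, h1, In.ivl (In.right h2 ((hA _).mp (S.1 : A.FullSubcategory).property).gt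
      ((hA _).mp (S'.1 : A.FullSubcategory).property).gt fun z hz => by linarith)
      (In.left h1 hY'.lt hY.lt fun z hz => by linarith), fun hZ0 => ?_⟩
    have : IsIso j.hom := (Triangle.isZero₃_iff_isIso₁ _ hZ).mp hZ0
    have : IsIso j := (ObjectProperty.isIso_hom_iff j).mp this
    have hge : S.1 ≤ S'.1 := Subobject.le_of_comm (inv j) (by rw [IsIso.inv_comp_eq, hj])
    exact hlt.not_ge hge
  constructor
  · constructor
    constructor
    have : ∀ X : C, Acc (s.StrictSub (openIvl a b)) X → ∀ S : StrictSubobject E,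
        (S.1 : A.FullSubcategory).obj = X → Acc (· < ·) S := by
      intro X hX
      induction hX with
      | intro X _ ih =>
        rintro S rfl
        refine ⟨_, fun S' hS' => ?_⟩
        obtain ⟨Y', v', w', hT', hY'⟩ := NormalMono.triMono hA hba S'.2.some hab
        obtain ⟨Y, v, w, hT, hY⟩ := NormalMono.triMono hA hba S.2.some hab
        obtain ⟨Z, h1, -, h2, h3⟩ := key S' S hS' Y' Y v' w' v w hT' hY' hT hY
        exact ih _ ⟨Z, h1, (hA _).mp (S'.1 : A.FullSubcategory).property,
          (hA _).mp (S.1 : A.FullSubcategory).property, h2, h3⟩ S' rfl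
    exact fun S => this _ (h _ ((hA _).mp (S.1 : A.FullSubcategory).property)).1 S rfl
  · constructor
    constructor
    have : ∀ Y : C, Acc (s.StrictQuot (openIvl a b)) Y → ∀ S : StrictSubobject E,
        ∀ v w, Triangle.mk S.1.arrow.hom (v : E.obj ⟶ Y) w ∈ distTriang C →
        s.In (openIvl a b) Y → Acc (· > ·) S := by
      intro Y hY
      induction hY with
      | intro Y _ ih =>
        intro S v w hT hY
        refine ⟨_, fun S' hS' => ?_⟩
        obtain ⟨Y', v', w', hT', hY'⟩ := NormalMono.triMono hA hba S'.2.some hab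
        obtain ⟨Z, -, h1, h2, h3⟩ := key S S' hS' Y Y' v w v' w' hT hY hT' hY'
        exact ih _ ⟨Z, h1, h2, hY, hY', h3⟩ S' v' w' hT' hY'
    intro S
    obtain ⟨Y, v, w, hT, hY⟩ := NormalMono.triMono hA hba S.2.some hab
    exact this _ (h _ hY).2 S v w hT hY

end

/-- The subcategory `P(I)` of the definition of local finiteness, for an open interval `I`. -/
theorem interval_Ioo_iff (s : PolySlicing C) {α β : PolyPhase} {γ : PolyPhase} (h1 : α < γ)
    (h2 : γ < β) (E : C) :
    s.interval (Set.Ioo α β) E ↔ s.In (openIvl α.val β.val) E := by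
  constructor
  · intro h
    refine ExtensionClosure.mono h ?_
    rintro E ⟨φ, hφ, hE⟩
    exact Or.inr ⟨φ, ⟨PolyPhase.val_lt.mpr hφ.1, PolyPhase.val_lt.mpr hφ.2⟩, hE⟩
  · intro h
    refine ExtensionClosure.mono h ?_
    rintro E (hE | ⟨φ, hφ, hE⟩)
    · exact ⟨γ, ⟨h1, h2⟩, s.P_of_isZero hE⟩
    · exact ⟨φ, ⟨PolyPhase.val_lt.mp hφ.1, PolyPhase.val_lt.mp hφ.2⟩, hE⟩

theorem isOfFiniteLength_interval_iff [IsTriangulated C] (s : PolySlicing C) (φ : PolyPhase)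
    {ε : ℝ} (h0 : 0 < ε) (h1 : ε ≤ 1 / 2) :
    IsOfFiniteLength (s.interval (Set.Ioo (φ + (-ε)) (φ + ε))).FullSubcategory ↔
      s.FiniteLength (openIvl (φ.val - cst ε) (φ.val + cst ε)) := by
  have h0' : 0 < cst ε := by
    rw [← map_zero cst, cst_lt]
    exact h0
  have h1' : cst ε + cst ε ≤ 1 := by
    rw [← map_add, ← map_one cst, cst_le]
    linarith
  have e1 : (φ + (-ε)).val = φ.val - cst ε := by
    rw [PolyPhase.val_add, map_neg, sub_eq_add_neg]
  have e2 : (φ + ε).val = φ.val + cst ε := PolyPhase.val_add _ _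
  have hA : ∀ E, s.interval (Set.Ioo (φ + (-ε)) (φ + ε)) E ↔
      s.In (openIvl (φ.val - cst ε) (φ.val + cst ε)) E := by
    intro E
    rw [← e1, ← e2]
    refine s.interval_Ioo_iff (γ := φ) ?_ ?_ E
    · rw [← PolyPhase.val_lt, e1]
      linarith
    · rw [← PolyPhase.val_lt, e2]
      linarith
  exact ⟨finiteLength_of_isOfFiniteLength hA (by linarith),
    fun h => h.isOfFiniteLength hA (by linarith) (by linarith)⟩

end PolySlicing

end FiniteLength

/-! ### Phases of objects for the deformed central charge -/

section Deformation

variable {C : Type u} [Category.{v} C] [HasZeroObject C] [HasShift C ℤ] [Preadditive C]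
  [∀ n : ℤ, (shiftFunctor C n).Additive] [Pretriangulated C]

/-- `χ` is a phase of the value of the central charge `W` at `E`. -/
def HasPhase (W : TriangulatedK0 C →+ ℂ[X]) (E : C) (χ : PolyPhase) : Prop :=
  χ.IsPhaseOf (W (k0Class E))

namespace HasPhase

variable {W : TriangulatedK0 C →+ ℂ[X]}

theorem not_isZero {E : C} {χ : PolyPhase} (h : HasPhase W E χ) : ¬ IsZero E := by
  intro hE
  apply PolyPhase.IsPhaseOf.ne_zero h
  rw [k0Class_eq_zero hE, map_zero]

theorem congr {E E' : C} {χ : PolyPhase} (h : HasPhase W E χ) (e : E ≅ E') : HasPhase W E' χ := by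
  rwa [HasPhase, ← k0Class_congr e]

theorem unique {E : C} {χ χ' : PolyPhase} (h : HasPhase W E χ) (h' : HasPhase W E χ')
    (h1 : χ.val < χ'.val + 2) (h2 : χ'.val < χ.val + 2) : χ = χ' :=
  PolyPhase.IsPhaseOf.unique h h' h1 h2

/-- The see-saw property of phases. -/
theorem between {X E Y : C} {α β γ : PolyPhase} (h : IsExt X E Y) (hX : HasPhase W X α)
    (hY : HasPhase W Y β) (hE : HasPhase W E γ) (h1 : α.val < β.val + 1) (h2 : β.val < α.val + 1)
    (h3 : γ.val < α.val + 1) (h4 : α.val < γ.val + 1) :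
    (α.val < γ.val ∧ γ.val < β.val) ∨ (α.val = γ.val ∧ γ.val = β.val) ∨
      (β.val < γ.val ∧ γ.val < α.val) := by
  refine PolyPhase.IsPhaseOf.between_add hX hY ?_ h1 h2 h3 h4
  rwa [← map_add, ← h.k0Class_eq]

theorem exists_mid {X E Y : C} {α β : PolyPhase} (h : IsExt X E Y) (hX : HasPhase W X α)
    (hY : HasPhase W Y β) (h1 : α.val < β.val + 1) (h2 : β.val < α.val + 1) :
    ∃ γ : PolyPhase, HasPhase W E γ ∧
      ((α.val ≤ γ.val ∧ γ.val ≤ β.val) ∨ (β.val ≤ γ.val ∧ γ.val ≤ α.val)) := by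
  have e : W (k0Class E) = W (k0Class X) + W (k0Class Y) := by rw [h.k0Class_eq, map_add]
  rw [HasPhase] at hX hY
  rcases le_total α.val β.val with h | h
  · obtain ⟨γ, hγ, h3, h4, -⟩ := hX.exists_add_of_le hY h h2
    exact ⟨γ, by rwa [HasPhase, e], Or.inl ⟨h3, h4⟩⟩
  · obtain ⟨γ, hγ, h3, h4, -⟩ := hY.exists_add_of_le hX h h1
    exact ⟨γ, by rwa [HasPhase, e, add_comm], Or.inr ⟨h3, h4⟩⟩

end HasPhase

/-- `W` changes the phases of the semistable objects of the slicing `s` by less than the small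
constant `e`, and intervals of a length which is large compared to `e` have finite length. -/
structure IsDeformation (s : PolySlicing C) (W : TriangulatedK0 C →+ ℂ[X]) (e : ℝ) : Prop where
  pos : 0 < e
  le : e ≤ 1 / 32
  exists_phase : ∀ (φ : PolyPhase) (E : C), s.P φ E → ¬ IsZero E →
    ∃ χ : PolyPhase, HasPhase W E χ ∧ φ.val - cst e < χ.val ∧ χ.val < φ.val + cst e
  finite : ∀ φ : PolyPhase,
    s.FiniteLength (PolySlicing.openIvl (φ.val - 16 * cst e) (φ.val + 16 * cst e))

/-- The semistable objects of phase `ψ` of the deformed slicing. Subobjects and quotients are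
tested in an interval of length `3 / 2`: this is long enough for the kernel, the image and the
cokernel of a morphism between two such objects of close phases to be admissible, while the
possible phases of a subobject `X`, whose `s`-phases lie between `ψ - 3 / 4` and `ψ + e`, still
lie in an interval of length less than `1`. -/
def deformedP (s : PolySlicing C) (W : TriangulatedK0 C →+ ℂ[X]) (e : ℝ) (ψ : PolyPhase) :
    ObjectProperty C := fun E =>
  IsZero E ∨ (s.In (PolySlicing.openIvl (ψ.val - cst e) (ψ.val + cst e)) E ∧ HasPhase W E ψ ∧
    ∀ X Y : C, IsExt X E Y → s.In (ψ.val - 3 / 4 < ·) X → s.In (· < ψ.val + 3 / 4) Y →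
      ∀ χ : PolyPhase, HasPhase W X χ → ψ.val - 1 < χ.val → χ.val < ψ.val + 1 → χ.val ≤ ψ.val)

/-- `E` is `W`-semistable of phase `ψ` in the interval from `x` to `y`. -/
def SemistableIn (s : PolySlicing C) (W : TriangulatedK0 C →+ ℂ[X]) (x y : PhaseField)
    (ψ : PolyPhase) (E : C) : Prop :=
  s.In (PolySlicing.openIvl x y) E ∧ HasPhase W E ψ ∧
    ∀ X Y : C, IsExt X E Y → s.In (PolySlicing.openIvl x y) X →
      s.In (PolySlicing.openIvl x y) Y →
      ∀ χ : PolyPhase, HasPhase W X χ → ψ.val - 1 < χ.val → χ.val < ψ.val + 1 → χ.val ≤ ψ.val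

namespace IsDeformation

open PolySlicing

variable {s : PolySlicing C} {W : TriangulatedK0 C →+ ℂ[X]} {e : ℝ} (hd : IsDeformation s W e)
include hd

theorem cst_pos : 0 < cst e := by
  rw [← map_zero cst, cst_lt]
  exact hd.pos

theorem cst_le_one : 32 * cst e ≤ 1 := by
  rw [← map_ofNat cst 32, ← map_mul, ← map_one cst, cst_le]
  linarith [hd.le]

/-- Nonzero objects with `s`-phases in a short interval have a `W`-phase, close to that
interval. -/
theorem exists_hasPhase {p : PhaseField → Prop} {E : C} (hE : s.In p E) {x y : PhaseField}
    (hp : ∀ z, p z → x ≤ z ∧ z ≤ y) (hxy : y + 2 * cst e ≤ x + 1) (hE0 : ¬ IsZero E) :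
    ∃ χ : PolyPhase, HasPhase W E χ ∧ x - cst e < χ.val ∧ χ.val < y + cst e := by
  suffices h : IsZero E ∨
      ∃ χ : PolyPhase, HasPhase W E χ ∧ x - cst e < χ.val ∧ χ.val < y + cst e from
    h.resolve_left hE0
  clear hE0
  induction hE with
  | of E hE =>
    rcases hE with hE | ⟨φ, hφ, hE⟩
    · exact Or.inl hE
    by_cases hE0 : IsZero E
    · exact Or.inl hE0
    obtain ⟨χ, h1, h2, h3⟩ := hd.exists_phase φ E hE hE0
    obtain ⟨h4, h5⟩ := hp _ hφ
    exact Or.inr ⟨χ, h1, by linarith, by linarith⟩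
  | ext T hT _ _ ih₁ ih₃ =>
    have hT := IsExt.of_dist T hT
    rcases ih₁ with h1 | ⟨α, h1, h2, h3⟩
    · obtain ⟨i⟩ := hT.iso_of_isZero_left h1
      rcases ih₃ with h4 | ⟨β, h4, h5, h6⟩
      · exact Or.inl (h4.of_iso i)
      · exact Or.inr ⟨β, h4.congr i.symm, h5, h6⟩
    · rcases ih₃ with h4 | ⟨β, h4, h5, h6⟩
      · obtain ⟨i⟩ := hT.iso_of_isZero_right h4
        exact Or.inr ⟨α, h1.congr i, h2, h3⟩
      · obtain ⟨γ, hγ, h | h⟩ := h1.exists_mid hT h4 (by linarith) (by linarith)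
        · exact Or.inr ⟨γ, hγ, by linarith, by linarith⟩
        · exact Or.inr ⟨γ, hγ, by linarith, by linarith⟩

/-- A `W`-phase at distance less than `1` from the expected interval lies close to it. -/
theorem phase_mem {p : PhaseField → Prop} {E : C} (hE : s.In p E) {x y : PhaseField}
    (hp : ∀ z, p z → x ≤ z ∧ z ≤ y) (hxy : y + 2 * cst e ≤ x + 1) {χ : PolyPhase}
    (hχ : HasPhase W E χ) (h1 : x - cst e - 1 ≤ χ.val) (h2 : χ.val ≤ y + cst e + 1) :
    x - cst e < χ.val ∧ χ.val < y + cst e := by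
  obtain ⟨χ', h3, h4, h5⟩ := hd.exists_hasPhase hE hp hxy hχ.not_isZero
  obtain rfl := hχ.unique h3 (by linarith) (by linarith)
  exact ⟨h4, h5⟩

omit hd in
theorem deformedP_congr {ψ : PolyPhase} {E E' : C} (h : deformedP s W e ψ E) (i : E ≅ E') :
    deformedP s W e ψ E' := by
  rcases h with h | ⟨h1, h2, h3⟩
  · exact Or.inl (h.of_iso i.symm)
  · exact Or.inr ⟨h1.congr i, h2.congr i, fun X Y h =>
      h3 X Y (h.congr (Iso.refl _) i.symm (Iso.refl _))⟩

omit hd in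
theorem deformedP_in {ψ : PolyPhase} {E : C} (h : deformedP s W e ψ E) :
    s.In (openIvl (ψ.val - cst e) (ψ.val + cst e)) E := by
  rcases h with h | ⟨h1, -, -⟩
  · exact In.of_isZero h
  · exact h1

theorem finiteLength {x y : PhaseField} (φ : PolyPhase) (h1 : φ.val - 16 * cst e ≤ x)
    (h2 : y ≤ φ.val + 16 * cst e) : s.FiniteLength (openIvl x y) :=
  (hd.finite φ).of_imp fun _ hE => hE.mono fun _ hz => ⟨h1.trans_lt hz.1, hz.2.trans_le h2⟩

omit hd in
/-- Subobjects in an interval of length at most `1` are detected by morphisms. -/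
theorem isZero_of_sub {x y : PhaseField} (hxy : y ≤ x + 1) {X E Y : C} (h : IsExt X E Y)
    (hX : s.In (openIvl x y) X) (hY : s.In (openIvl x y) Y) (hXE : ∀ f : X ⟶ E, f = 0) :
    IsZero X :=
  h.isZero_left_of_hom hXE fun f =>
    hX.hom_eq_zero (hY.shift_neg_one (q := (· < y - 1)) fun z hz => by linarith [hz.2])
      (fun z w hz hw => by linarith [hz.1]) f

omit hd in
theorem isZero_of_quotient {x y : PhaseField} (hxy : y ≤ x + 1) {X E Y : C} (h : IsExt X E Y)
    (hX : s.In (openIvl x y) X) (hY : s.In (openIvl x y) Y) (hEY : ∀ f : E ⟶ Y, f = 0) :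
    IsZero Y :=
  h.isZero_right_of_hom hEY fun f =>
    (hX.shift_one (q := (x + 1 < ·)) fun z hz => by linarith [hz.1]).hom_eq_zero hY
      (fun z w hz hw => by linarith [hw.2]) f

theorem semistableIn_le_phase_of_quotient {x y : PhaseField} {ψ : PolyPhase} {X E Y : C}
    (hE : SemistableIn s W x y ψ E) (hxy : y ≤ x + 1 / 4) (h1 : x - cst e < ψ.val)
    (h2 : ψ.val < y + cst e) (h : IsExt X E Y) (hX : s.In (openIvl x y) X)
    (hY : s.In (openIvl x y) Y) {χ : PolyPhase} (hχ : HasPhase W Y χ)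
    (h3 : ψ.val - 1 < χ.val) (h4 : χ.val < ψ.val + 1) : ψ.val ≤ χ.val := by
  have hk := hd.cst_pos
  have hk' := hd.cst_le_one
  obtain ⟨hE1, hE2, hE3⟩ := hE
  by_contra! hlt
  obtain ⟨h3, h4⟩ := hd.phase_mem hY (fun z hz => ⟨hz.1.le, hz.2.le⟩) (by linarith) hχ
    (by linarith) (by linarith)
  by_cases hX0 : IsZero X
  · obtain ⟨i⟩ := h.iso_of_isZero_left hX0
    have := hχ.unique (hE2.congr i) (by linarith) (by linarith)
    rw [this] at hlt
    exact lt_irrefl _ hlt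
  · obtain ⟨α, h5, h6, h7⟩ := hd.exists_hasPhase hX (fun z hz => ⟨hz.1.le, hz.2.le⟩)
      (by linarith) hX0
    have h8 := hE3 X Y h hX hY α h5 (by linarith) (by linarith)
    rcases h5.between h hχ hE2 (by linarith) (by linarith) (by linarith) (by linarith) with
      h | h | h <;> linarith

variable [IsTriangulated C]

/-- Quotients of semistable objects do not have smaller phases. -/
theorem le_phase_of_quotient {ψ : PolyPhase} {X E Y : C} (hE : deformedP s W e ψ E)
    (hE0 : ¬ IsZero E) (h : IsExt X E Y) (hX : s.In (ψ.val - 3 / 4 < ·) X)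
    (hY : s.In (· < ψ.val + 3 / 4) Y) {χ : PolyPhase} (hχ : HasPhase W Y χ)
    (h1 : ψ.val - 1 < χ.val) (h2 : χ.val < ψ.val + 1) : ψ.val ≤ χ.val := by
  have hk := hd.cst_pos
  have hk' := hd.cst_le_one
  obtain ⟨hE1, hE2, hE3⟩ := hE.resolve_left hE0
  by_contra! hlt
  have hX' : s.In (openIvl (ψ.val - 3 / 4) (ψ.val + cst e)) X :=
    In.ivl hX (In.left h hE1.lt hY fun z hz => by linarith)
  have hY' : s.In (openIvl (ψ.val - cst e) (ψ.val + 3 / 4)) Y :=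
    In.ivl (In.right h hE1.gt hX fun z hz => by linarith) hY
  obtain ⟨h3, h4⟩ := hd.phase_mem hY' (fun z hz => ⟨hz.1.le, hz.2.le⟩) (by linarith) hχ
    (by linarith) (by linarith)
  by_cases hX0 : IsZero X
  · obtain ⟨i⟩ := h.iso_of_isZero_left hX0
    have := hχ.unique (hE2.congr i) (by linarith) (by linarith)
    rw [this] at hlt
    exact lt_irrefl _ hlt
  · obtain ⟨α, h5, h6, h7⟩ := hd.exists_hasPhase hX' (fun z hz => ⟨hz.1.le, hz.2.le⟩)
      (by linarith) hX0
    have h8 := hE3 X Y h hX hY α h5 (by linarith) (by linarith)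
    rcases h5.between h hχ hE2 (by linarith) (by linarith) (by linarith) (by linarith) with
      h | h | h <;> linarith

/-! ### Morphisms between semistable objects of the deformed slicing -/

/-- There are no nonzero morphisms from semistable objects to semistable objects of smaller
phase. For close phases, a morphism `f` factors through an object `I` which is a quotient of the
source and a subobject of the target. -/
theorem deformedP_hom_eq_zero {ψ₁ ψ₂ : PolyPhase} (hψ : ψ₂ < ψ₁) {E F : C}
    (hE : deformedP s W e ψ₁ E) (hF : deformedP s W e ψ₂ F) (f : E ⟶ F) : f = 0 := by
  have hk := hd.cst_pos
  have hk' := hd.cst_le_one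
  rw [← PolyPhase.val_lt] at hψ
  have hE1 := deformedP_in hE
  have hF1 := deformedP_in hF
  by_cases hfar : ψ₂.val + 2 * cst e ≤ ψ₁.val
  · exact hE1.hom_eq_zero hF1 (fun z w hz hw => by linarith [hz.1, hw.2]) f
  push Not at hfar
  by_cases hE0 : IsZero E
  · exact hE0.eq_of_src _ _
  by_cases hF0 : IsZero F
  · exact hF0.eq_of_tgt _ _
  obtain ⟨N, n, n', hN⟩ := distinguished_cocone_triangle₁ f
  obtain ⟨K, M, ⟨k, m, m', hM⟩, hK1, hM1⟩ := s.exists_truncation N (p := (ψ₁.val - 3 / 4 < ·))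
    fun _ _ h1 h2 => h1.trans h2
  obtain ⟨I, i, i', hI⟩ := distinguished_cocone_triangle (k ≫ n)
  let o := Triangulated.someOctahedron rfl hM hN hI
  have hfac : i ≫ o.m₃ = f := o.comm₃
  have hKEI : IsExt K E I := ⟨_, _, _, hI⟩
  have hMIF : IsExt M I F := ⟨_, _, _, o.mem⟩
  have hIFM := hMIF.rot
  have hMle : s.In (· ≤ ψ₁.val - 3 / 4) M := hM1.mono fun z hz => not_lt.mp hz
  have hI1 : s.In (ψ₁.val - cst e < ·) I :=
    In.right hKEI hE1.gt hK1 fun z hz => by linarith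
  have hI2 : s.In (· < ψ₂.val + cst e) I :=
    In.mid hMIF (hMle.mono fun z hz => by linarith) hF1.lt
  by_cases hI0 : IsZero I
  · have hi : ∀ g : I ⟶ F, i ≫ g = 0 := fun g => hI0.eq_of_src g 0 ▸ comp_zero
    rw [← hfac]
    exact hi _
  obtain ⟨χ, h1, h2, h3⟩ := hd.exists_hasPhase (In.ivl hI1 hI2)
    (x := ψ₁.val - cst e) (y := ψ₂.val + cst e) (fun z hz => ⟨hz.1.le, hz.2.le⟩)
    (by linarith) hI0
  have h4 := hd.le_phase_of_quotient hE hE0 hKEI hK1 (hI2.mono fun z hz => by linarith) h1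
    (by linarith) (by linarith)
  have h5 := (hF.resolve_left hF0).2.2 I _ hIFM (hI1.mono fun z hz => by linarith)
    (hMle.shift_one fun z hz => by linarith) χ h1 (by linarith) (by linarith)
  linarith

/-! ### Semistability in short intervals -/

theorem semistableIn_mem_ivl {x y : PhaseField} {ψ : PolyPhase} {E : C}
    (hE : SemistableIn s W x y ψ E) (hxy : y ≤ x + 1 / 4) (hx : x + cst e ≤ ψ.val)
    (hy : ψ.val + cst e ≤ y) : s.In (openIvl (ψ.val - cst e) (ψ.val + cst e)) E := by
  have hk := hd.cst_pos
  have hk' := hd.cst_le_one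
  have hE1 := hE.1
  apply In.ivl
  · obtain ⟨X, Y, h, hX, hY⟩ := s.exists_truncation E (p := (ψ.val - cst e < ·))
      fun _ _ h1 h2 => h1.trans h2
    have hXi : s.In (openIvl x y) X := In.ivl (hX.mono fun z hz => by linarith)
      (In.left h hE1.lt hY fun z hz => by linarith [not_lt.mp hz])
    have hYx : s.In (x < ·) Y := In.right h hE1.gt hX fun z hz => by linarith
    have hYi : s.In (openIvl x y) Y := In.ivl hYx (hY.mono fun z hz => by linarith [not_lt.mp hz])
    have hY0 : IsZero Y := by
      by_contra hY0
      have hY' := hYx.and hY (fun _ _ h1 h2 => h1.trans h2) fun _ _ h1 h2 h3 => h1 (h3.trans h2)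
      obtain ⟨χ, h1, h2, h3⟩ := hd.exists_hasPhase hY' (y := ψ.val - cst e)
        (fun z hz => ⟨hz.1.le, not_lt.mp hz.2⟩) (by linarith) hY0
      have := hd.semistableIn_le_phase_of_quotient hE hxy (by linarith) (by linarith) h hXi hYi h1
        (by linarith) (by linarith)
      linarith
    obtain ⟨i⟩ := h.iso_of_isZero_right hY0
    exact hX.congr i
  · obtain ⟨X, Y, h, hX, hY⟩ := s.exists_truncation E (p := (ψ.val + cst e ≤ ·))
      fun _ _ h1 h2 => h1.trans h2.le
    have hXy : s.In (· < y) X := In.left h hE1.lt hY fun z hz => by linarith [not_le.mp hz]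
    have hXi : s.In (openIvl x y) X := In.ivl (hX.mono fun z hz => by linarith) hXy
    have hYi : s.In (openIvl x y) Y := In.ivl (In.right h hE1.gt hX fun z hz => by linarith)
      (hY.mono fun z hz => by linarith [not_le.mp hz])
    have hX0 : IsZero X := by
      by_contra hX0
      have hX' := hX.and hXy (fun _ _ h1 h2 => h1.trans h2.le) fun _ _ h1 h2 => h2.trans h1
      obtain ⟨χ, h1, h2, h3⟩ := hd.exists_hasPhase hX' (x := ψ.val + cst e)
        (fun z hz => ⟨hz.1, hz.2.le⟩) (by linarith) hX0
      have := hE.2.2 X Y h hXi hYi χ h1 (by linarith) (by linarith)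
      linarith
    obtain ⟨i⟩ := h.iso_of_isZero_left hX0
    exact (hY.congr i.symm).mono fun z hz => not_le.mp hz

/-- Semistability in a short interval whose end points have distance at least `e` from `ψ`
implies semistability in the sense of `deformedP`: truncating a destabilizing subobject and the
corresponding quotient one obtains a destabilizing subobject in the short interval. -/
theorem deformedP_of_semistableIn {x y : PhaseField} {ψ : PolyPhase} {E : C}
    (hE : SemistableIn s W x y ψ E) (hxy : y ≤ x + 1 / 4) (hx : x + cst e ≤ ψ.val)
    (hy : ψ.val + cst e ≤ y) : deformedP s W e ψ E := by
  have hk := hd.cst_pos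
  have hk' := hd.cst_le_one
  have hE1 := hd.semistableIn_mem_ivl hE hxy hx hy
  refine Or.inr ⟨hE1, hE.2.1, fun X Y h hX hY χ hχ h1 h2 => ?_⟩
  by_contra! hlt
  have hXi : s.In (openIvl (ψ.val - 3 / 4) (ψ.val + cst e)) X :=
    In.ivl hX (In.left h hE1.lt hY fun z hz => by linarith)
  obtain ⟨h3, h4⟩ := hd.phase_mem hXi (fun z hz => ⟨hz.1.le, hz.2.le⟩) (by linarith) hχ
    (by linarith) (by linarith)
  obtain ⟨X', Z, hXX, hX', hZ⟩ := hX.exists_truncation (r := (x < ·))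
    (fun _ _ h1 h2 => h1.trans h2) fun _ _ h1 h2 => h1.trans h2
  have hX'i : s.In (openIvl x (ψ.val + cst e)) X' := In.ivl (hX'.mono fun z hz => hz.1)
    (In.left hXX hXi.lt hZ fun z hz => by linarith [not_lt.mp hz.1])
  have hZi : ∀ z, (¬ x < z ∧ ψ.val - 3 / 4 < z) → ψ.val - 3 / 4 ≤ z ∧ z ≤ x :=
    fun z hz => ⟨hz.2.le, not_lt.mp hz.1⟩
  obtain ⟨α, hα, hα1, hα2⟩ : ∃ α, HasPhase W X' α ∧ ψ.val < α.val ∧ α.val < ψ.val + 2 * cst e := by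
    by_cases hZ0 : IsZero Z
    · obtain ⟨i⟩ := hXX.iso_of_isZero_right hZ0
      exact ⟨χ, hχ.congr i.symm, hlt, by linarith⟩
    obtain ⟨ζ, hζ, h5, h6⟩ := hd.exists_hasPhase hZ hZi (by linarith) hZ0
    have hX0 : ¬ IsZero X' := by
      intro hX0
      obtain ⟨i⟩ := hXX.iso_of_isZero_left hX0
      obtain rfl := (hχ.congr i).unique hζ (by linarith) (by linarith)
      linarith
    obtain ⟨α, hα, h7, h8⟩ := hd.exists_hasPhase hX'i (fun z hz => ⟨hz.1.le, hz.2.le⟩)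
      (by linarith) hX0
    refine ⟨α, hα, ?_, by linarith⟩
    rcases hα.between hXX hζ hχ (by linarith) (by linarith) (by linarith) (by linarith) with
      h | h | h <;> linarith
  obtain ⟨Y', hXY', hZY'⟩ := h.assoc_left hXX
  have hY'1 : s.In (· < ψ.val + 3 / 4) Y' :=
    In.mid hZY' (hZ.mono fun z hz => by linarith [(hZi z hz).2]) hY
  have hY'2 : s.In (ψ.val - cst e < ·) Y' :=
    In.right hXY' hE1.gt hX'i fun z hz => by linarith [hz.1]
  obtain ⟨V, U, hVU, hV, hU⟩ := hY'2.exists_truncation (r := (y ≤ ·))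
    (fun _ _ h1 h2 => h1.trans h2) fun _ _ h1 h2 => h1.trans h2.le
  obtain ⟨X'', hX''E, hX''V⟩ := hXY'.assoc_right hVU
  have hUi : s.In (openIvl x y) U :=
    hU.mono fun z hz => ⟨by linarith [hz.2], not_le.mp hz.1⟩
  have hX''i : s.In (openIvl x y) X'' := by
    refine In.ivl (In.mid hX''V hX'i.gt (hV.mono fun z hz => by linarith [hz.1])) ?_
    exact In.left hX''E (hE1.lt.mono fun z hz => by linarith) hUi fun z hz => by linarith [hz.2]
  have hV1 : s.In (· < ψ.val + 3 / 4) V :=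
    In.left hVU hY'1 hUi fun z hz => by linarith [hz.2]
  obtain ⟨γ, hγ, hγ1, hγ2⟩ : ∃ γ, HasPhase W X'' γ ∧ ψ.val < γ.val ∧ γ.val < ψ.val + 1 := by
    by_cases hV0 : IsZero V
    · obtain ⟨i⟩ := hX''V.iso_of_isZero_right hV0
      exact ⟨α, hα.congr i, hα1, by linarith⟩
    have hV2 := (hV.mono (q := (y ≤ ·)) fun z hz => hz.1).and hV1
      (fun _ _ h1 h2 => h1.trans h2.le) fun _ _ h1 h2 => h2.trans h1
    obtain ⟨ν, hν, h5, h6⟩ := hd.exists_hasPhase hV2 (fun z hz => ⟨hz.1, hz.2.le⟩)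
      (by linarith) hV0
    obtain ⟨γ, hγ, h | h⟩ := hα.exists_mid hX''V hν (by linarith) (by linarith)
    · exact ⟨γ, hγ, by linarith, by linarith⟩
    · exact ⟨γ, hγ, by linarith, by linarith⟩
  have := hE.2.2 X'' U hX''E hX''i hUi γ hγ (by linarith) (by linarith)
  linarith

/-- In an interval of finite length, every nonzero object has a semistable subobject of at least
the same phase. -/
theorem exists_semistableIn_sub {x y : PhaseField} (hfin : s.FiniteLength (openIvl x y))
    (hxy : y ≤ x + 1 / 4) {E : C} (hE : s.In (openIvl x y) E) {ψ : PolyPhase}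
    (hψ : HasPhase W E ψ) (h1 : x - cst e < ψ.val) (h2 : ψ.val < y + cst e) :
    ∃ (X Y : C) (χ : PolyPhase), IsExt X E Y ∧ s.In (openIvl x y) Y ∧ SemistableIn s W x y χ X ∧
      ψ.val ≤ χ.val ∧ χ.val < y + cst e := by
  have hk := hd.cst_pos
  have hk' := hd.cst_le_one
  have hacc := (hfin E hE).1
  induction hacc generalizing ψ with
  | intro E _ ih =>
    by_cases hss : SemistableIn s W x y ψ E
    · exact ⟨E, 0, ψ, .of_isZero_right E (isZero_zero C), In.of_isZero (isZero_zero C), hss,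
        le_rfl, h2⟩
    · rw [SemistableIn] at hss
      push Not at hss
      obtain ⟨X, Y, h, hX, hY, χ, hχ, h3, h4, h5⟩ := hss hE hψ
      have hY0 : ¬ IsZero Y := by
        intro hY0
        obtain ⟨i⟩ := h.iso_of_isZero_right hY0
        obtain rfl := hψ.unique (hχ.congr i) (by linarith) (by linarith)
        exact lt_irrefl _ h5
      obtain ⟨h6, h7⟩ := hd.phase_mem hX (fun z hz => ⟨hz.1.le, hz.2.le⟩) (by linarith) hχ
        (by linarith) (by linarith)
      obtain ⟨X', Y', χ', h8, h9, h10, h11, h12⟩ := ih X ⟨Y, h, hX, hE, hY, hY0⟩ hX hχ h6 h7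
      obtain ⟨Y'', h13, h14⟩ := h.assoc_left h8
      exact ⟨X', Y'', χ', h13, In.mid h14 h9 hY, h10, h5.le.trans h11, h12⟩

/-- In an interval of finite length, every nonzero object has a semistable quotient of at most
the same phase. -/
theorem exists_semistableIn_quotient {x y : PhaseField} (hfin : s.FiniteLength (openIvl x y))
    (hxy : y ≤ x + 1 / 4) {E : C} (hE : s.In (openIvl x y) E) {ψ : PolyPhase}
    (hψ : HasPhase W E ψ) (h1 : x - cst e < ψ.val) (h2 : ψ.val < y + cst e) :
    ∃ (X Y : C) (χ : PolyPhase), IsExt X E Y ∧ s.In (openIvl x y) X ∧ SemistableIn s W x y χ Y ∧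
      χ.val ≤ ψ.val ∧ x - cst e < χ.val := by
  have hk := hd.cst_pos
  have hk' := hd.cst_le_one
  have hacc := (hfin E hE).2
  induction hacc generalizing ψ with
  | intro E _ ih =>
    by_cases hss : SemistableIn s W x y ψ E
    · exact ⟨0, E, ψ, .of_isZero_left (isZero_zero C) E, In.of_isZero (isZero_zero C), hss,
        le_rfl, h1⟩
    · rw [SemistableIn] at hss
      push Not at hss
      obtain ⟨X, Y, h, hX, hY, χ, hχ, h3, h4, h5⟩ := hss hE hψ
      have hY0 : ¬ IsZero Y := by
        intro hY0
        obtain ⟨i⟩ := h.iso_of_isZero_right hY0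
        obtain rfl := hψ.unique (hχ.congr i) (by linarith) (by linarith)
        exact lt_irrefl _ h5
      obtain ⟨h6, h7⟩ := hd.phase_mem hX (fun z hz => ⟨hz.1.le, hz.2.le⟩) (by linarith) hχ
        (by linarith) (by linarith)
      obtain ⟨β, hβ, h8, h9⟩ := hd.exists_hasPhase hY (fun z hz => ⟨hz.1.le, hz.2.le⟩)
        (by linarith) hY0
      have hβψ : β.val < ψ.val := by
        rcases hχ.between h hβ hψ (by linarith) (by linarith) (by linarith) (by linarith) with
          h | h | h <;> linarith
      obtain ⟨X', Y', χ', h10, h11, h12, h13, h14⟩ :=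
        ih Y ⟨X, h, hX, hE, hY, hχ.not_isZero⟩ hY hβ h8 h9
      obtain ⟨X'', h15, h16⟩ := h.assoc_right h10
      exact ⟨X'', Y', χ', h15, In.mid h16 hX h11, h12, h13.trans hβψ.le, h14⟩

theorem exists_deformedP_sub {x y : PhaseField} (hfin : s.FiniteLength (openIvl x y))
    (hxy : y ≤ x + 1 / 4) {E : C} (hE : s.In (openIvl x y) E) (hEy : s.In (· < y - 2 * cst e) E)
    {ψ : PolyPhase} (hψ : HasPhase W E ψ) (h1 : x + cst e ≤ ψ.val) (h2 : ψ.val < y + cst e) :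
    ∃ (X Y : C) (χ : PolyPhase), IsExt X E Y ∧ s.In (openIvl x y) X ∧ s.In (openIvl x y) Y ∧
      deformedP s W e χ X ∧ ¬ IsZero X ∧ ψ.val ≤ χ.val := by
  have hk := hd.cst_pos
  have hk' := hd.cst_le_one
  obtain ⟨X, Y, χ, h, hY, hX, h3, h4⟩ :=
    hd.exists_semistableIn_sub hfin hxy hE hψ (by linarith) h2
  have hX' : s.In (openIvl x (y - 2 * cst e)) X :=
    In.ivl hX.1.gt (In.left h hEy hY fun z hz => by linarith [hz.2])
  obtain ⟨h5, h6⟩ := hd.phase_mem hX' (fun z hz => ⟨hz.1.le, hz.2.le⟩) (by linarith) hX.2.1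
    (by linarith) (by linarith)
  exact ⟨X, Y, χ, h, hX.1, hY, hd.deformedP_of_semistableIn hX hxy (by linarith) (by linarith),
    hX.2.1.not_isZero, h3⟩

theorem exists_deformedP_quotient {x y : PhaseField} (hfin : s.FiniteLength (openIvl x y))
    (hxy : y ≤ x + 1 / 4) {E : C} (hE : s.In (openIvl x y) E) (hEx : s.In (x + 2 * cst e < ·) E)
    {ψ : PolyPhase} (hψ : HasPhase W E ψ) (h1 : x - cst e < ψ.val) (h2 : ψ.val + cst e ≤ y) :
    ∃ (X Y : C) (χ : PolyPhase), IsExt X E Y ∧ s.In (openIvl x y) X ∧ s.In (openIvl x y) Y ∧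
      deformedP s W e χ Y ∧ ¬ IsZero Y ∧ χ.val ≤ ψ.val := by
  have hk := hd.cst_pos
  have hk' := hd.cst_le_one
  obtain ⟨X, Y, χ, h, hX, hY, h3, h4⟩ :=
    hd.exists_semistableIn_quotient hfin hxy hE hψ h1 (by linarith)
  have hY' : s.In (openIvl (x + 2 * cst e) y) Y :=
    In.ivl (In.right h hEx hX fun z hz => by linarith [hz.1]) hY.1.lt
  obtain ⟨h5, h6⟩ := hd.phase_mem hY' (fun z hz => ⟨hz.1.le, hz.2.le⟩) (by linarith) hY.2.1
    (by linarith) (by linarith)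
  exact ⟨X, Y, χ, h, hX, hY.1, hd.deformedP_of_semistableIn hY hxy (by linarith) (by linarith),
    hY.2.1.not_isZero, h3⟩

/-- An object which receives no morphisms from semistable objects of bigger phase is
semistable. -/
theorem deformedP_of_hom_eq_zero {x y : PhaseField} (hfin : s.FiniteLength (openIvl x y))
    (hxy : y ≤ x + 1 / 4) {B : C} (hB : s.In (openIvl x y) B) (hBy : s.In (· < y - 2 * cst e) B)
    {ψ : PolyPhase} (hψ : HasPhase W B ψ) (h1 : x + cst e ≤ ψ.val) (h2 : ψ.val + cst e ≤ y)
    (hhom : ∀ (χ : PolyPhase) (X : C), ψ.val < χ.val → deformedP s W e χ X →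
      ∀ f : X ⟶ B, f = 0) : deformedP s W e ψ B := by
  have hk := hd.cst_pos
  have hk' := hd.cst_le_one
  refine hd.deformedP_of_semistableIn ⟨hB, hψ, fun X Y h hX hY χ hχ h3 h4 => ?_⟩ hxy h1 h2
  by_contra! hlt
  obtain ⟨h5, h6⟩ := hd.phase_mem hX (fun z hz => ⟨hz.1.le, hz.2.le⟩) (by linarith) hχ
    (by linarith) (by linarith)
  have hXy : s.In (· < y - 2 * cst e) X := In.left h hBy hY fun z hz => by linarith [hz.2]
  obtain ⟨X', Y', χ', h7, hX', hY', h8, h9, h10⟩ :=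
    hd.exists_deformedP_sub hfin hxy hX hXy hχ (by linarith) h6
  obtain ⟨Y'', h11, h12⟩ := h.assoc_left h7
  exact h9 (isZero_of_sub (by linarith) h11 hX' (In.mid h12 hY' hY)
    (hhom χ' X' (by linarith) h8))

end IsDeformation

end Deformation

/-! ### Torsion pairs of the deformed slicing -/

section TorsionPairs

variable {C : Type u} [Category.{v} C] [HasZeroObject C] [HasShift C ℤ] [Preadditive C]
  [∀ n : ℤ, (shiftFunctor C n).Additive] [Pretriangulated C]

/-- The extension-closed subcategory generated by the deformed semistable objects of phases
`> t`, and by the original semistable objects of phases `≥ t + e`, which will turn out to be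
iterated extensions of the former. Having them among the generators allows to reduce the
existence of torsion pairs to objects with phases in a short interval around `t`. -/
def Tors (s : PolySlicing C) (W : TriangulatedK0 C →+ ℂ[X]) (e : ℝ) (t : PhaseField) :
    ObjectProperty C :=
  ExtensionClosure fun E => (∃ ψ : PolyPhase, t < ψ.val ∧ deformedP s W e ψ E) ∨
    s.In (t + cst e ≤ ·) E

/-- The extension-closed subcategory generated by the deformed semistable objects of phases
`≤ t`, and by the original semistable objects of phases `≤ t - e`. -/
def TorsFree (s : PolySlicing C) (W : TriangulatedK0 C →+ ℂ[X]) (e : ℝ) (t : PhaseField) :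
    ObjectProperty C :=
  ExtensionClosure fun E => (∃ ψ : PolyPhase, ψ.val ≤ t ∧ deformedP s W e ψ E) ∨
    s.In (· ≤ t - cst e) E

namespace IsDeformation

open PolySlicing

variable {s : PolySlicing C} {W : TriangulatedK0 C →+ ℂ[X]} {e : ℝ}

theorem deformedP_shift {ψ : PolyPhase} {E : C} :
    deformedP s W e (ψ + (1 : ℝ)) (E⟦(1 : ℤ)⟧) ↔ deformedP s W e ψ E := by
  have hphase : ∀ (X : C) (χ : PolyPhase), HasPhase W (X⟦(1 : ℤ)⟧) (χ + (1 : ℝ)) ↔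
      HasPhase W X χ := by
    intro X χ
    have h0 : k0Class (X⟦(1 : ℤ)⟧) = -k0Class X := by
      have := (IsExt.of_isZero_right X (isZero_zero C)).rot.k0Class_eq
      rw [k0Class_eq_zero (isZero_zero C)] at this
      exact (neg_eq_of_add_eq_zero_right this.symm).symm
    rw [HasPhase, HasPhase, h0, map_neg, PolyPhase.isPhaseOf_iff, PolyPhase.isPhaseOf_iff]
    refine eventually_congr ((χ.fn_add 1).mono fun m hm => ?_)
    have he : Complex.exp (Real.pi * (χ + (1 : ℝ)).fn m * Complex.I) =
        -Complex.exp (Real.pi * χ.fn m * Complex.I) := by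
      rw [hm]
      push_cast
      rw [mul_add, add_mul, mul_one, Complex.exp_add, Complex.exp_pi_mul_I, mul_neg_one]
    rw [he, Polynomial.eval_neg]
    simp only [mul_neg, neg_inj]
  have hv := ψ.val_add_one
  have hin : ∀ {p q : PhaseField → Prop} {X : C}, (∀ z, q (z + 1) ↔ p z) →
      (s.In q (X⟦(1 : ℤ)⟧) ↔ s.In p X) := by
    intro p q X hpq
    constructor
    · intro h
      refine (h.shift_neg_one (q := p) fun z hz => ?_).congr (shiftShiftNeg X (1 : ℤ))
      rw [← hpq]
      simpa using hz
    · exact fun h => h.shift_one fun z hz => (hpq z).mpr hz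
  constructor
  · rintro (h | ⟨h1, h2, h3⟩)
    · refine Or.inl ?_
      exact (Functor.map_isZero (shiftFunctor C (-1 : ℤ)) h).of_iso (shiftShiftNeg E (1 : ℤ)).symm
    · refine Or.inr ⟨(hin fun z => ?_).mp h1, (hphase _ _).mp h2, fun X Y h hX hY χ hχ h4 h5 => ?_⟩
      · rw [hv]
        constructor <;> rintro ⟨h, h'⟩ <;> constructor <;> linarith
      · have := h3 _ _ (h.shift 1) (hX.shift_one fun z hz => by rw [hv]; linarith)
          (hY.shift_one fun z hz => by rw [hv]; linarith) _ ((hphase _ _).mpr hχ)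
          (by rw [hv, χ.val_add_one]; linarith) (by rw [hv, χ.val_add_one]; linarith)
        rw [hv, χ.val_add_one] at this
        linarith
  · rintro (h | ⟨h1, h2, h3⟩)
    · exact Or.inl (Functor.map_isZero _ h)
    · refine Or.inr ⟨(hin fun z => ?_).mpr h1, (hphase _ _).mpr h2,
        fun X Y h hX hY χ hχ h4 h5 => ?_⟩
      · rw [hv]
        constructor <;> rintro ⟨h, h'⟩ <;> constructor <;> linarith
      · rw [hv] at hX hY h4 h5 ⊢
        have hχ' : HasPhase W (X⟦(-1 : ℤ)⟧) (χ + (-1 : ℝ)) := by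
          rw [← hphase, PolyPhase.add_add, neg_add_cancel, PolyPhase.add_zero']
          exact hχ.congr (shiftNegShift X (1 : ℤ)).symm
        have hχv : (χ + (-1 : ℝ)).val = χ.val - 1 := by
          rw [PolyPhase.val_add, map_neg, map_one, sub_eq_add_neg]
        have := h3 _ _ ((h.shift (-1)).congr (Iso.refl _) (shiftShiftNeg E (1 : ℤ)) (Iso.refl _))
          (hX.shift_neg_one fun z hz => by linarith)
          (hY.shift_neg_one fun z hz => by linarith) _ hχ' (by linarith) (by linarith)
        linarith

theorem deformedP_shift_neg {ψ : PolyPhase} {E : C} (h : deformedP s W e ψ E) :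
    deformedP s W e (ψ + (-1 : ℝ)) (E⟦(-1 : ℤ)⟧) := by
  rw [← deformedP_shift, PolyPhase.add_add, neg_add_cancel, PolyPhase.add_zero']
  exact deformedP_congr h (shiftNegShift E (1 : ℤ)).symm

theorem Tors.mono {t t' : PhaseField} {E : C} (h : Tors s W e t E) (ht : t' ≤ t) :
    Tors s W e t' E := by
  refine ExtensionClosure.mono h fun E hE => hE.imp ?_ fun h => ?_
  · rintro ⟨ψ, h1, h2⟩
    exact ⟨ψ, ht.trans_lt h1, h2⟩
  · exact h.mono fun z hz => by linarith

theorem TorsFree.mono {t t' : PhaseField} {E : C} (h : TorsFree s W e t E) (ht : t ≤ t') :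
    TorsFree s W e t' E := by
  refine ExtensionClosure.mono h fun E hE => hE.imp ?_ fun h => ?_
  · rintro ⟨ψ, h1, h2⟩
    exact ⟨ψ, h1.trans ht, h2⟩
  · exact h.mono fun z hz => by linarith

theorem Tors.of_in {t : PhaseField} {E : C} (h : s.In (t + cst e ≤ ·) E) : Tors s W e t E :=
  .of _ (Or.inr h)

theorem TorsFree.of_in {t : PhaseField} {E : C} (h : s.In (· ≤ t - cst e) E) :
    TorsFree s W e t E :=
  .of _ (Or.inr h)

theorem Tors.of_deformedP {t : PhaseField} {ψ : PolyPhase} {E : C} (h : deformedP s W e ψ E)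
    (ht : t < ψ.val) : Tors s W e t E :=
  .of _ (Or.inl ⟨ψ, ht, h⟩)

theorem TorsFree.of_deformedP {t : PhaseField} {ψ : PolyPhase} {E : C}
    (h : deformedP s W e ψ E) (ht : ψ.val ≤ t) : TorsFree s W e t E :=
  .of _ (Or.inl ⟨ψ, ht, h⟩)

theorem Tors.congr {t : PhaseField} {E E' : C} (h : Tors s W e t E) (i : E ≅ E') :
    Tors s W e t E' := by
  refine ExtensionClosure.congr h i fun X Y i h => h.imp ?_ fun h => h.congr i
  rintro ⟨ψ, h1, h2⟩
  exact ⟨ψ, h1, deformedP_congr h2 i⟩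

theorem TorsFree.congr {t : PhaseField} {E E' : C} (h : TorsFree s W e t E) (i : E ≅ E') :
    TorsFree s W e t E' := by
  refine ExtensionClosure.congr h i fun X Y i h => h.imp ?_ fun h => h.congr i
  rintro ⟨ψ, h1, h2⟩
  exact ⟨ψ, h1, deformedP_congr h2 i⟩

theorem Tors.mid {t : PhaseField} {X E Y : C} (h : IsExt X E Y) (hX : Tors s W e t X)
    (hY : Tors s W e t Y) : Tors s W e t E :=
  ExtensionClosure.isExt h hX hY

theorem TorsFree.mid {t : PhaseField} {X E Y : C} (h : IsExt X E Y) (hX : TorsFree s W e t X)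
    (hY : TorsFree s W e t Y) : TorsFree s W e t E :=
  ExtensionClosure.isExt h hX hY

theorem Tors.right {t : PhaseField} {X E Y : C} (h : IsExt X E Y) (hE : Tors s W e t E)
    (hX : Tors s W e t X) : Tors s W e t Y := by
  refine Tors.mid h.rot hE (ExtensionClosure.shift hX 1 fun E hE => ?_)
  rcases hE with ⟨ψ, h1, h2⟩ | h
  · exact Tors.of_deformedP (deformedP_shift.mpr h2) (by rw [ψ.val_add_one]; linarith)
  · exact Tors.of_in (h.shift_one fun z hz => by linarith)

theorem TorsFree.left {t : PhaseField} {X E Y : C} (h : IsExt X E Y) (hE : TorsFree s W e t E)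
    (hY : TorsFree s W e t Y) : TorsFree s W e t X := by
  refine TorsFree.mid h.invRot (ExtensionClosure.shift hY (-1) fun E hE => ?_) hE
  rcases hE with ⟨ψ, h1, h2⟩ | h
  · refine TorsFree.of_deformedP (deformedP_shift_neg h2) ?_
    rw [PolyPhase.val_add, map_neg, map_one]
    linarith
  · exact TorsFree.of_in (h.shift_neg_one fun z hz => by linarith)

variable (hd : IsDeformation s W e)
include hd

theorem in_of_tors {t : PhaseField} {E : C} (h : Tors s W e t E) : s.In (t - cst e < ·) E := by
  have hk := hd.cst_pos
  refine ExtensionClosure.bind h fun E hE => ?_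
  change s.In (t - cst e < ·) E
  rcases hE with ⟨ψ, h1, h2⟩ | h
  · exact (deformedP_in h2).mono fun z hz => by linarith [hz.1]
  · exact h.mono fun z hz => by linarith

theorem in_of_torsFree {t : PhaseField} {E : C} (h : TorsFree s W e t E) :
    s.In (· < t + cst e) E := by
  have hk := hd.cst_pos
  refine ExtensionClosure.bind h fun E hE => ?_
  change s.In (· < t + cst e) E
  rcases hE with ⟨ψ, h1, h2⟩ | h
  · exact (deformedP_in h2).mono fun z hz => by linarith [hz.2]
  · exact h.mono fun z hz => by linarith

variable [IsTriangulated C]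

theorem tors_hom_eq_zero {t : PhaseField} {E F : C} (hE : Tors s W e t E)
    (hF : TorsFree s W e t F) (f : E ⟶ F) : f = 0 := by
  have hk := hd.cst_pos
  refine ExtensionClosure.hom_eq_zero hE hF (fun A B hA hB f => ?_) f
  rcases hA with ⟨ψ, h1, h2⟩ | hA
  · rcases hB with ⟨χ, h3, h4⟩ | hB
    · exact hd.deformedP_hom_eq_zero (PolyPhase.val_lt.mp (h3.trans_lt h1)) h2 h4 f
    · exact (deformedP_in h2).hom_eq_zero hB (fun z w hz hw => by linarith [hz.1]) f
  · rcases hB with ⟨χ, h3, h4⟩ | hB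
    · exact hA.hom_eq_zero (deformedP_in h4) (fun z w hz hw => by linarith [hw.2]) f
    · exact hA.hom_eq_zero hB (fun z w hz hw => by linarith) f

theorem phase_le_of_torsFree {x y t : PhaseField} (hfin : s.FiniteLength (openIvl x y))
    (hxy : y ≤ x + 1 / 4) {B : C} (hB : s.In (openIvl x y) B) (hBy : s.In (· < y - 2 * cst e) B)
    {ψ : PolyPhase} (hψ : HasPhase W B ψ) (h1 : x + cst e ≤ ψ.val) (h2 : ψ.val < y + cst e)
    (hBt : TorsFree s W e t B) : ψ.val ≤ t := by
  obtain ⟨X, Y, χ, h3, hX, hY, h4, h5, h6⟩ := hd.exists_deformedP_sub hfin hxy hB hBy hψ h1 h2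
  by_contra! hlt
  exact h5 (isZero_of_sub (by linarith) h3 hX hY
    (hd.tors_hom_eq_zero (Tors.of_deformedP h4 (hlt.trans_le h6)) hBt))

theorem lt_phase_of_tors {x y t : PhaseField} (hfin : s.FiniteLength (openIvl x y))
    (hxy : y ≤ x + 1 / 4) {B : C} (hB : s.In (openIvl x y) B) (hBx : s.In (x + 2 * cst e < ·) B)
    {ψ : PolyPhase} (hψ : HasPhase W B ψ) (h1 : x - cst e < ψ.val) (h2 : ψ.val + cst e ≤ y)
    (hBt : Tors s W e t B) : t < ψ.val := by
  obtain ⟨X, Y, χ, h3, hX, hY, h4, h5, h6⟩ := hd.exists_deformedP_quotient hfin hxy hB hBx hψ h1 h2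
  by_contra! hlt
  exact h5 (isZero_of_quotient (by linarith) h3 hX hY
    fun f => hd.tors_hom_eq_zero hBt (TorsFree.of_deformedP h4 (h6.trans hlt)) f)

omit hd in
/-- In an interval of finite length, the biggest torsion subobject exists. -/
theorem exists_tors_sub {x y t : PhaseField} (hfin : s.FiniteLength (openIvl x y)) {E : C}
    (hE : s.In (openIvl x y) E) :
    ∃ T F, IsExt T E F ∧ Tors s W e t T ∧ s.In (openIvl x y) F ∧
      ∀ X Y, IsExt X F Y → s.In (openIvl x y) X → s.In (openIvl x y) Y → Tors s W e t X →
        IsZero X := by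
  have hacc := (hfin E hE).2
  induction hacc with
  | intro E _ ih =>
    by_cases hmax : ∀ X Y, IsExt X E Y → s.In (openIvl x y) X → s.In (openIvl x y) Y →
        Tors s W e t X → IsZero X
    · exact ⟨0, E, .of_isZero_left (isZero_zero C) E, Tors.of_in (In.of_isZero (isZero_zero C)),
        hE, hmax⟩
    · push Not at hmax
      obtain ⟨X, Y, h, hX, hY, hXt, hX0⟩ := hmax
      obtain ⟨T, F, h1, h2, h3, h4⟩ := ih Y ⟨X, h, hX, hE, hY, hX0⟩ hY
      obtain ⟨T', h5, h6⟩ := h.assoc_right h1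
      exact ⟨T', F, h5, Tors.mid h6 hXt h2, h3, h4⟩

omit hd in
/-- In an interval of finite length, the biggest torsion-free quotient exists. -/
theorem exists_torsFree_quotient {x y t : PhaseField} (hfin : s.FiniteLength (openIvl x y))
    {E : C} (hE : s.In (openIvl x y) E) :
    ∃ K F, IsExt K E F ∧ TorsFree s W e t F ∧ s.In (openIvl x y) K ∧ s.In (openIvl x y) F ∧
      ∀ X Y, IsExt X K Y → s.In (openIvl x y) X → s.In (openIvl x y) Y → TorsFree s W e t Y →
        IsZero Y := by
  have hacc := (hfin E hE).1
  induction hacc with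
  | intro E _ ih =>
    by_cases hmax : ∀ X Y, IsExt X E Y → s.In (openIvl x y) X → s.In (openIvl x y) Y →
        TorsFree s W e t Y → IsZero Y
    · exact ⟨E, 0, .of_isZero_right E (isZero_zero C),
        TorsFree.of_in (In.of_isZero (isZero_zero C)), hE, In.of_isZero (isZero_zero C), hmax⟩
    · push Not at hmax
      obtain ⟨X, Y, h, hX, hY, hYt, hY0⟩ := hmax
      obtain ⟨K, F, h1, h2, h3, h4, h5⟩ := ih X ⟨Y, h, hX, hE, hY, hY0⟩ hX
      obtain ⟨F', h6, h7⟩ := h.assoc_left h1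
      exact ⟨K, F', h6, TorsFree.mid h7 h2 hYt, h3, In.mid h7 h4 hY, h5⟩

/-- An object without torsion subobjects and torsion-free quotients vanishes: its phases lie
between `t - e` and `t + e`, and it has a semistable subobject of phase `≤ t` and a semistable
quotient of phase `> t`, but the former phase is at least the latter. -/
theorem isZero_of_sub_of_quotient {x y t : PhaseField} (hfin : s.FiniteLength (openIvl x y))
    (hxy : y ≤ x + 1 / 4) (hx : x + 3 * cst e ≤ t) (hy : t + 3 * cst e ≤ y) {K : C}
    (hK : s.In (openIvl x y) K)
    (hsub : ∀ X Y, IsExt X K Y → s.In (openIvl x y) X → s.In (openIvl x y) Y → Tors s W e t X →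
      IsZero X)
    (hquot : ∀ X Y, IsExt X K Y → s.In (openIvl x y) X → s.In (openIvl x y) Y →
      TorsFree s W e t Y → IsZero Y) : IsZero K := by
  have hk := hd.cst_pos
  have hk' := hd.cst_le_one
  have hKy : s.In (· < t + cst e) K := by
    obtain ⟨X, Y, h, hX, hY⟩ := s.exists_truncation K (p := (t + cst e ≤ ·))
      fun _ _ h1 h2 => h1.trans h2.le
    have hXi : s.In (openIvl x y) X := In.ivl (hX.mono fun z hz => by linarith)
      (In.left h hK.lt hY fun z hz => by linarith [not_le.mp hz])
    have hYi : s.In (openIvl x y) Y := In.ivl (In.right h hK.gt hX fun z hz => by linarith)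
      (hY.mono fun z hz => by linarith [not_le.mp hz])
    obtain ⟨i⟩ := h.iso_of_isZero_left (hsub X Y h hXi hYi (Tors.of_in hX))
    exact (hY.congr i.symm).mono fun z hz => not_le.mp hz
  have hKx : s.In (t - cst e < ·) K := by
    obtain ⟨X, Y, h, hX, hY⟩ := s.exists_truncation K (p := (t - cst e < ·))
      fun _ _ h1 h2 => h1.trans h2
    have hXi : s.In (openIvl x y) X := In.ivl (hX.mono fun z hz => by linarith)
      (In.left h hK.lt hY fun z hz => by linarith [not_lt.mp hz])
    have hYi : s.In (openIvl x y) Y := In.ivl (In.right h hK.gt hX fun z hz => by linarith)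
      (hY.mono fun z hz => by linarith [not_lt.mp hz])
    obtain ⟨i⟩ := h.iso_of_isZero_right
      (hquot X Y h hXi hYi (TorsFree.of_in (hY.mono fun z hz => not_lt.mp hz)))
    exact hX.congr i
  by_contra hK0
  obtain ⟨ψ, hψ, h1, h2⟩ := hd.exists_hasPhase (In.ivl hKx hKy)
    (fun z hz => ⟨hz.1.le, hz.2.le⟩) (by linarith) hK0
  obtain ⟨X, Y, χ, h3, h4, h5, h6, h7, h8⟩ := hd.exists_deformedP_sub hfin hxy hK
    (hKy.mono fun z hz => by linarith) hψ (by linarith) (by linarith)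
  obtain ⟨X', Y', χ', h9, h10, h11, h12, h13, h14⟩ := hd.exists_deformedP_quotient hfin hxy hK
    (hKx.mono fun z hz => by linarith) hψ (by linarith) (by linarith)
  have h15 : χ.val ≤ t := by
    by_contra! hlt
    exact h7 (hsub X Y h3 h4 h5 (Tors.of_deformedP h6 hlt))
  have h16 : t < χ'.val := by
    by_contra! hlt
    exact h13 (hquot X' Y' h9 h10 h11 (TorsFree.of_deformedP h12 hlt))
  linarith

/-- Every object is an extension of a torsion-free object by a torsion object. Truncating, one may
assume that its original phases lie in a short interval around `τ`, where finite length applies. -/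
theorem exists_torsion_pair (τ : PolyPhase) (E : C) :
    ∃ T F, IsExt T E F ∧ Tors s W e τ.val T ∧ TorsFree s W e τ.val F := by
  have hk := hd.cst_pos
  have hk' := hd.cst_le_one
  have hfin := hd.finiteLength (x := τ.val - 3 * cst e) (y := τ.val + 3 * cst e) τ
    (by linarith) (by linarith)
  obtain ⟨X₁, E', h1, hX₁, hE'⟩ := s.exists_truncation E (p := (τ.val + cst e ≤ ·))
    fun _ _ h1 h2 => h1.trans h2.le
  obtain ⟨M, X₃, h2, hM, hX₃⟩ := s.exists_truncation E' (p := (τ.val - cst e < ·))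
    fun _ _ h1 h2 => h1.trans h2
  have hMi : s.In (openIvl (τ.val - 3 * cst e) (τ.val + 3 * cst e)) M :=
    (In.ivl hM (In.left (p := (· < τ.val + cst e)) h2 (hE'.mono fun z hz => not_le.mp hz) hX₃
      fun z hz => by linarith [not_lt.mp hz])).mono
      fun z hz => ⟨by linarith [hz.1], by linarith [hz.2]⟩
  obtain ⟨T, F, h3, hT, hF, hFsub⟩ := exists_tors_sub (W := W) (e := e) (t := τ.val) hfin hMi
  obtain ⟨K, G, h4, hG, hK, hGi, hKquot⟩ :=
    exists_torsFree_quotient (W := W) (e := e) (t := τ.val) hfin hF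
  have hK0 : IsZero K := by
    refine hd.isZero_of_sub_of_quotient hfin (by linarith) (by linarith) (by linarith) hK
      (fun X Y h hX hY hXt => ?_) hKquot
    obtain ⟨Y', h5, h6⟩ := h4.assoc_left h
    exact hFsub X Y' h5 hX (In.mid h6 hY hGi) hXt
  obtain ⟨i⟩ := h4.iso_of_isZero_left hK0
  obtain ⟨F', h5, h6⟩ := h2.assoc_left h3
  obtain ⟨T', h7, h8⟩ := h1.assoc_right h5
  exact ⟨T', F', h7, Tors.mid h8 (Tors.of_in hX₁) hT, TorsFree.mid h6 (TorsFree.congr hG i.symm)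
    (TorsFree.of_in (hX₃.mono fun z hz => not_lt.mp hz))⟩

/-! ### Harder-Narasimhan filtrations for the deformed slicing -/

/-- A nonzero object whose deformed phases lie in a short interval has a semistable quotient such
that the kernel has bigger phases: an object which is not semistable is replaced by its
torsion-free part with respect to its own phase, a proper strict quotient. -/
theorem exists_last_factor (σ : PolyPhase) {B : C} {ρ t : PhaseField} (hσ : σ.val ≤ ρ)
    (ht : t ≤ σ.val + cst e) (hB : Tors s W e ρ B) (hB' : TorsFree s W e t B)
    (hB0 : ¬ IsZero B) :
    ∃ (K B' : C) (ψ : PolyPhase), IsExt K B B' ∧ deformedP s W e ψ B' ∧ ¬ IsZero B' ∧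
      Tors s W e ψ.val K ∧ ρ < ψ.val ∧ ψ.val ≤ t := by
  have hk := hd.cst_pos
  have hk' := hd.cst_le_one
  have hfin := hd.finiteLength (x := σ.val - 3 * cst e) (y := σ.val + 4 * cst e) σ
    (by linarith) (by linarith)
  have hIn : ∀ {X : C} {t : PhaseField}, Tors s W e ρ X → TorsFree s W e t X →
      t ≤ σ.val + cst e → s.In (openIvl (σ.val - cst e) (σ.val + 2 * cst e)) X := fun h h' ht =>
    In.ivl ((hd.in_of_tors h).mono fun z hz => by linarith)
      ((hd.in_of_torsFree h').mono fun z hz => by linarith)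
  have hIn' : ∀ {X : C}, s.In (openIvl (σ.val - cst e) (σ.val + 2 * cst e)) X →
      s.In (openIvl (σ.val - 3 * cst e) (σ.val + 4 * cst e)) X := fun h =>
    h.mono fun z hz => ⟨by linarith [hz.1], by linarith [hz.2]⟩
  have hacc := (hfin B (hIn' (hIn hB hB' ht))).2
  induction hacc generalizing t with
  | intro B _ ih =>
    have hBi := hIn hB hB' ht
    obtain ⟨ψ, hψ, h1, h2⟩ := hd.exists_hasPhase hBi (fun z hz => ⟨hz.1.le, hz.2.le⟩)
      (by linarith) hB0
    have hψt := hd.phase_le_of_torsFree hfin (by linarith) (hIn' hBi)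
      (hBi.mono fun z hz => by linarith [hz.2]) hψ (by linarith) (by linarith) hB'
    have hlt : ∀ {r : PhaseField}, Tors s W e r B → r < ψ.val := fun hBr =>
      hd.lt_phase_of_tors hfin (by linarith) (hIn' hBi)
        (hBi.mono fun z hz => by linarith [hz.1]) hψ (by linarith) (by linarith) hBr
    obtain ⟨X, F, h, hX, hF⟩ := hd.exists_torsion_pair ψ B
    have hXρ : Tors s W e ρ X := Tors.mono hX (hlt hB).le
    have hFρ : Tors s W e ρ F := Tors.right h hB hXρ
    by_cases hX0 : IsZero X
    · obtain ⟨i⟩ := h.iso_of_isZero_left hX0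
      have hBψ := TorsFree.congr hF i.symm
      refine ⟨0, B, ψ, .of_isZero_left (isZero_zero C) B, ?_, hB0,
        Tors.of_in (In.of_isZero (isZero_zero C)), hlt hB, hψt⟩
      exact hd.deformedP_of_hom_eq_zero hfin (by linarith) (hIn' hBi)
        (hBi.mono fun z hz => by linarith [hz.2]) hψ (by linarith) (by linarith)
        fun χ Y hχ hY => hd.tors_hom_eq_zero (Tors.of_deformedP hY hχ) hBψ
    · have hF0 : ¬ IsZero F := by
        intro hF0
        obtain ⟨i⟩ := h.iso_of_isZero_right hF0
        exact lt_irrefl _ (hlt (Tors.congr hX i))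
      have hXi : s.In (openIvl (σ.val - cst e) (σ.val + 2 * cst e)) X :=
        hIn hXρ (TorsFree.left h hB' (TorsFree.mono hF hψt)) ht
      have hFi := hIn hFρ hF (hψt.trans ht)
      obtain ⟨K, B', ψ', h3, h4, h5, h6, h7, h8⟩ := ih F ⟨X, h, hIn' hXi, hIn' hBi, hIn' hFi, hX0⟩
        (hψt.trans ht) hFρ hF hF0
      obtain ⟨K', h9, h10⟩ := h.assoc_right h3
      exact ⟨K', B', ψ', h9, h4, h5, Tors.mid h10 (Tors.mono hX h8) h6, h7, h8.trans hψt⟩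

omit hd [IsTriangulated C] in
theorem hasHN_mono {P : PolyPhase → ObjectProperty C} {t t' : PhaseField} {E : C}
    (h : HasHN P t E) (ht : t' ≤ t) : HasHN P t' E := by
  cases h with
  | zero _ _ hE => exact .zero _ _ hE
  | snoc _ φ K _ B h1 h2 h3 h4 h5 => exact .snoc _ φ K _ B (ht.trans_lt h1) h2 h3 h4 h5

omit hd [IsTriangulated C] in
theorem hasHN_congr {P : PolyPhase → ObjectProperty C} {t : PhaseField} {E E' : C}
    (h : HasHN P t E) (i : E ≅ E') : HasHN P t E' := by
  cases h with
  | zero _ _ hE => exact .zero _ _ (hE.of_iso i.symm)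
  | snoc _ φ K _ B h1 h2 h3 h4 h5 =>
    exact .snoc _ φ K _ B h1 h2 h3 h4 (h5.congr (Iso.refl _) i (Iso.refl _))

/-- Harder-Narasimhan filtrations extend along extensions by objects with smaller phases in a
short interval. -/
theorem hasHN_of_isExt (σ : PolyPhase) {B : C} {ρ : PhaseField} (h1 : σ.val ≤ ρ)
    (h2 : ρ ≤ σ.val + cst e) (hB : Tors s W e ρ B) (hB' : TorsFree s W e (σ.val + cst e) B)
    {K E : C} (h : IsExt K E B) (hK : HasHN (deformedP s W e) (σ.val + cst e) K) :
    HasHN (deformedP s W e) ρ E := by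
  have hk := hd.cst_pos
  have hk' := hd.cst_le_one
  have hfin := hd.finiteLength (x := σ.val - cst e) (y := σ.val + 2 * cst e) σ
    (by linarith) (by linarith)
  have hIn : ∀ {X : C} {r : PhaseField}, σ.val ≤ r → Tors s W e r X →
      TorsFree s W e (σ.val + cst e) X →
      s.In (openIvl (σ.val - cst e) (σ.val + 2 * cst e)) X := fun hr h h' =>
    In.ivl ((hd.in_of_tors h).mono fun z hz => by linarith)
      ((hd.in_of_torsFree h').mono fun z hz => by linarith)
  have hacc := (hfin B (hIn h1 hB hB')).1
  induction hacc generalizing ρ E with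
  | intro B _ ih =>
    by_cases hB0 : IsZero B
    · obtain ⟨i⟩ := h.iso_of_isZero_right hB0
      exact hasHN_congr (hasHN_mono hK h2) i
    obtain ⟨K', B₁, ψ, h3, h4, h5, h6, h7, h8⟩ :=
      hd.exists_last_factor σ h1 le_rfl hB hB' hB0
    have hB₁ : TorsFree s W e (σ.val + cst e) B₁ := TorsFree.of_deformedP h4 h8
    have hK' : TorsFree s W e (σ.val + cst e) K' := TorsFree.left h3 hB' hB₁
    have hσψ : σ.val ≤ ψ.val := h1.trans h7.le
    obtain ⟨K'', h9, h10⟩ := h.assoc_right h3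
    refine .snoc _ ψ K'' _ B₁ h7 (ih K' ⟨B₁, h3, hIn hσψ h6 hK', hIn h1 hB hB',
      hIn h1 (Tors.of_deformedP h4 h7) hB₁, h5⟩ hσψ h8 h6 hK' h10) h4 h5 h9

/-- An object whose deformed phases are bounded on both sides has a Harder-Narasimhan filtration:
the range of phases is cut into intervals of length `e` by means of torsion pairs. -/
theorem hasHN_of_tors_of_torsFree (n : ℕ) (σ : PolyPhase) {E : C} (hE : Tors s W e σ.val E)
    (hE' : TorsFree s W e (σ.val + n * cst e) E) : HasHN (deformedP s W e) σ.val E := by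
  have hk := hd.cst_pos
  induction n generalizing σ E with
  | zero =>
    refine .zero _ _ ?_
    rw [IsZero.iff_id_eq_zero]
    rw [Nat.cast_zero, zero_mul, add_zero] at hE'
    exact hd.tors_hom_eq_zero hE hE' _
  | succ n ih =>
    have hv : (σ + e).val = σ.val + cst e := PolyPhase.val_add _ _
    obtain ⟨K, B, h, hK, hB⟩ := hd.exists_torsion_pair (σ + e) E
    have hn : (0 : PhaseField) ≤ n * cst e := by positivity
    push_cast at hE'
    have hKE : TorsFree s W e ((σ + e).val + n * cst e) K := by
      refine TorsFree.left h (TorsFree.mono hE' ?_) (TorsFree.mono hB ?_)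
      · rw [hv]
        linarith
      · linarith
    have h1 := ih (σ + e) hK hKE
    rw [hv] at h1 hB hK
    exact hd.hasHN_of_isExt σ le_rfl (by linarith)
      (Tors.right h hE (Tors.mono hK (by linarith))) hB h h1

end IsDeformation

end TorsionPairs

/-! ### The deformed slicing -/

section Slicing

variable {C : Type u} [Category.{v} C] [HasZeroObject C] [HasShift C ℤ] [Preadditive C]
  [∀ n : ℤ, (shiftFunctor C n).Additive] [Pretriangulated C]

/-- The inductively built filtration of a nonzero object, as a Harder-Narasimhan filtration. -/
theorem HasHN.exists_hnFiltration {P : PolyPhase → ObjectProperty C} {t : PhaseField} {X : C}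
    (h : HasHN P t X) (hX : ¬ IsZero X) :
    ∃ F : HNFiltration P X, t < (F.phase (Fin.last F.n)).val := by
  induction h with
  | zero t E hE => exact absurd hE hX
  | snoc t φ K E B ht hK hB hB' h ih =>
    by_cases hK0 : IsZero K
    · have hext : ∀ i : Fin (0 + 1), IsExt (![K, E] i.castSucc) (![K, E] i.succ) B := by
        intro i
        fin_cases i
        exact h
      choose f g k hT using hext
      exact ⟨{  n := 0
                phase := fun _ => φ
                phase_anti := fun i j hij => absurd hij (by omega)
                E := ![K, E]
                A := fun _ => B
                f := f
                g := g
                h := k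
                distinguished := hT
                isZero_bot := hK0
                isoTop := Iso.refl _
                semistable := fun _ => hB
                nonzero := fun _ => hB' }, ht⟩
    · obtain ⟨F, hF⟩ := ih hK0
      have hext : ∀ i : Fin (F.n + 2),
          IsExt (Fin.snoc (α := fun _ => C) F.E E i.castSucc)
            (Fin.snoc (α := fun _ => C) F.E E i.succ) (Fin.snoc (α := fun _ => C) F.A B i) := by
        intro i
        induction i using Fin.lastCases with
        | last =>
          rw [Fin.succ_last, Fin.snoc_last, Fin.snoc_last, Fin.snoc_castSucc]
          exact h.congr F.isoTop.symm (Iso.refl _) (Iso.refl _)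
        | cast i =>
          rw [Fin.succ_castSucc, Fin.snoc_castSucc, Fin.snoc_castSucc, Fin.snoc_castSucc]
          exact ⟨_, _, _, F.distinguished i⟩
      choose f g k hT using hext
      refine ⟨{ n := F.n + 1
                phase := Fin.snoc (α := fun _ => PolyPhase) F.phase φ
                phase_anti := ?_
                E := Fin.snoc (α := fun _ => C) F.E E
                A := Fin.snoc (α := fun _ => C) F.A B
                f := f
                g := g
                h := k
                distinguished := hT
                isZero_bot := ?_
                isoTop := eqToIso (Fin.snoc_last _ _)
                semistable := ?_
                nonzero := ?_ }, ?_⟩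
      · intro i j hij
        induction j using Fin.lastCases with
        | last =>
          induction i using Fin.lastCases with
          | last => exact absurd hij (lt_irrefl _)
          | cast i =>
            rw [Fin.snoc_last, Fin.snoc_castSucc, ← PolyPhase.val_lt]
            exact hF.trans_le (PolyPhase.val_le.mpr (F.phase_anti.antitone (Fin.le_last i)))
        | cast j =>
          induction i using Fin.lastCases with
          | last => exact absurd hij (not_lt.mpr (Fin.le_last _))
          | cast i =>
            rw [Fin.snoc_castSucc, Fin.snoc_castSucc]
            exact F.phase_anti (by simpa using hij)
      · have : (0 : Fin (F.n + 1 + 2)) = Fin.castSucc 0 := rfl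
        rw [this, Fin.snoc_castSucc]
        exact F.isZero_bot
      · intro i
        induction i using Fin.lastCases with
        | last => simpa using hB
        | cast i => simpa using F.semistable i
      · intro i
        induction i using Fin.lastCases with
        | last => simpa using hB'
        | cast i => simpa using F.nonzero i
      · simpa using ht

namespace HNFiltration

open PolySlicing

variable {s : PolySlicing C} {X : C} (F : HNFiltration s.P X)
include F

theorem in_E (i : Fin (F.n + 2)) :
    s.In (fun z => (F.phase (Fin.last F.n)).val ≤ z ∧ z ≤ (F.phase 0).val) (F.E i) := by
  induction i using Fin.induction with
  | zero => exact In.of_isZero F.isZero_bot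
  | succ i ih =>
    refine In.mid ⟨_, _, _, F.distinguished i⟩ ih (In.of_P (F.semistable i) ⟨?_, ?_⟩)
    · exact PolyPhase.val_le.mpr (F.phase_anti.antitone (Fin.le_last i))
    · exact PolyPhase.val_le.mpr (F.phase_anti.antitone (Fin.zero_le i))

theorem in_top :
    s.In (fun z => (F.phase (Fin.last F.n)).val ≤ z ∧ z ≤ (F.phase 0).val) X :=
  (F.in_E (Fin.last _)).congr F.isoTop

theorem exists_hom_last : ∃ A, s.P (F.phase (Fin.last F.n)) A ∧ ∃ f : X ⟶ A, f ≠ 0 := by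
  refine ⟨F.A (Fin.last _), F.semistable _, ?_⟩
  by_contra! h
  refine F.nonzero (Fin.last _) (IsExt.isZero_right_of_hom
    (⟨_, _, _, F.distinguished (Fin.last _)⟩ : IsExt _ _ _) (fun f => ?_) fun f => ?_)
  · rw [← cancel_epi F.isoTop.inv, comp_zero]
    exact h _
  · refine ((F.in_E _).shift_one (q := ((F.phase (Fin.last F.n)).val < ·))
      fun z hz => by linarith [hz.1]).hom_eq_zero
      (In.of_P (p := (· ≤ (F.phase (Fin.last F.n)).val)) (F.semistable _) le_rfl)
      (fun z w hz hw => hw.trans_lt hz) f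

theorem exists_hom_first : ∃ A, s.P (F.phase 0) A ∧ ∃ f : A ⟶ X, f ≠ 0 := by
  refine ⟨F.A 0, F.semistable _, ?_⟩
  by_contra! h
  have key : ∀ (i : Fin (F.n + 2)) (f : F.A 0 ⟶ F.E i), f = 0 := by
    intro i
    induction i using Fin.reverseInduction with
    | last =>
      intro f
      rw [← cancel_mono F.isoTop.hom, zero_comp]
      exact h _
    | cast i ih =>
      refine (IsExt.invRot ⟨_, _, _, F.distinguished i⟩).hom_to_mid (fun f => ?_) ih
      refine (In.of_P (p := ((F.phase 0).val ≤ ·)) (F.semistable 0) le_rfl).hom_eq_zero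
        ((In.of_P (p := (· ≤ (F.phase 0).val)) (F.semistable i) ?_).shift_neg_one
          (q := (· < (F.phase 0).val)) fun z hz => by linarith)
        (fun z w hz hw => hw.trans_le hz) f
      exact PolyPhase.val_le.mpr (F.phase_anti.antitone (Fin.zero_le i))
  obtain ⟨i⟩ := IsExt.iso_of_isZero_left ⟨_, _, _, F.distinguished 0⟩ F.isZero_bot
  refine F.nonzero 0 ?_
  rw [IsZero.iff_id_eq_zero, ← cancel_mono i.inv, zero_comp]
  exact key _ _

end HNFiltration

namespace PolySlicing

/-- If the semistable objects of `t` have `s`-phases at distance less than `e`, then the extremal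
phases of an object for `s` and `t` have distance at most `e`. -/
theorem dist_le {s t : PolySlicing C} {e : ℝ}
    (h : ∀ ψ E, t.P ψ E → s.In (openIvl (ψ.val - cst e) (ψ.val + cst e)) E) :
    s.dist t ≤ ENNReal.ofReal e := by
  have hin : ∀ {p q : PhaseField → Prop} {X : C}, t.In p X →
      (∀ z w, p z → z - cst e < w → w < z + cst e → q w) → s.In q X := by
    intro p q X hX hpq
    refine ExtensionClosure.bind hX fun E hE => ?_
    change s.In q E
    rcases hE with hE | ⟨φ, hφ, hE⟩
    · exact In.of_isZero hE
    · exact (h φ E hE).mono fun w hw => hpq _ _ hφ hw.1 hw.2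
  have hreal : ∀ φ ψ : PolyPhase, ψ.val - cst e < φ.val → φ.val < ψ.val + cst e →
      |φ.infty - ψ.infty| ≤ e := by
    intro φ ψ h1 h2
    rw [sub_lt_iff_lt_add, ← PolyPhase.val_add, PolyPhase.val_lt] at h1
    rw [← PolyPhase.val_add, PolyPhase.val_lt] at h2
    have h1 := PolyPhase.infty_le_of_le h1.le
    have h2 := PolyPhase.infty_le_of_le h2.le
    rw [PolyPhase.infty_add] at h1 h2
    rw [abs_le]
    constructor <;> linarith
  refine iSup_le fun X => iSup_le fun hX => ?_
  refine max_le (ENNReal.ofReal_le_ofReal (hreal _ _ ?_ ?_))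
    (ENNReal.ofReal_le_ofReal (hreal _ _ ?_ ?_))
  · by_contra! hlt
    obtain ⟨A, hA, f, hf⟩ := (s.hn X hX).exists_hom_last
    refine hf ((hin (q := fun z => (t.phiMinus X hX).val - cst e < z) (t.hn X hX).in_top
      fun z w hz h1 h2 => ?_).hom_eq_zero
      (In.of_P (p := (· ≤ (s.phiMinus X hX).val)) hA le_rfl) (fun z w hz hw => ?_) f)
    · have : (t.phiMinus X hX).val ≤ z := hz.1
      linarith
    · linarith
  · by_contra! hlt
    obtain ⟨A, hA, f, hf⟩ := (t.hn X hX).exists_hom_last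
    refine hf ((s.hn X hX).in_top.hom_eq_zero (h _ _ hA) (fun z w hz hw => ?_) f)
    have h1 : (s.phiMinus X hX).val ≤ z := hz.1
    have h2 : w < (t.phiMinus X hX).val + cst e := hw.2
    linarith
  · by_contra! hlt
    obtain ⟨A, hA, f, hf⟩ := (t.hn X hX).exists_hom_first
    refine hf ((h _ _ hA).hom_eq_zero (s.hn X hX).in_top (fun z w hz hw => ?_) f)
    have h1 : w ≤ (s.phiPlus X hX).val := hw.2
    have h2 : (t.phiPlus X hX).val - cst e < z := hz.1
    linarith
  · by_contra! hlt
    obtain ⟨A, hA, f, hf⟩ := (s.hn X hX).exists_hom_first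
    refine hf ((In.of_P (p := ((s.phiPlus X hX).val ≤ ·)) hA le_rfl).hom_eq_zero
      (hin (q := fun z => z < (t.phiPlus X hX).val + cst e) (t.hn X hX).in_top
        fun z w hz h1 h2 => ?_) (fun z w hz hw => ?_) f)
    · have : z ≤ (t.phiPlus X hX).val := hz.2
      linarith
    · linarith

end PolySlicing

namespace IsDeformation

open PolySlicing

variable {s : PolySlicing C} {W : TriangulatedK0 C →+ ℂ[X]} {e : ℝ} [IsTriangulated C]

/-- The deformed semistable objects of a given phase are closed under extensions, since the
extension receives no morphism from semistable objects of bigger phase. -/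
theorem deformedP_ext (hd : IsDeformation s W e) {ψ : PolyPhase} {X E Y : C} (h : IsExt X E Y)
    (hX : deformedP s W e ψ X) (hY : deformedP s W e ψ Y) : deformedP s W e ψ E := by
  have hk := hd.cst_pos
  have hk' := hd.cst_le_one
  by_cases hX0 : IsZero X
  · obtain ⟨i⟩ := h.iso_of_isZero_left hX0
    exact deformedP_congr hY i.symm
  by_cases hY0 : IsZero Y
  · obtain ⟨i⟩ := h.iso_of_isZero_right hY0
    exact deformedP_congr hX i
  have hE : s.In (openIvl (ψ.val - cst e) (ψ.val + cst e)) E :=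
    In.mid h (deformedP_in hX) (deformedP_in hY)
  obtain ⟨γ, hγ, hγψ⟩ := (hX.resolve_left hX0).2.1.exists_mid h (hY.resolve_left hY0).2.1
    (by linarith) (by linarith)
  obtain rfl : γ = ψ := by
    rw [← PolyPhase.val_inj]
    rcases hγψ with h | h <;> linarith
  refine hd.deformedP_of_hom_eq_zero (x := γ.val - 3 * cst e) (y := γ.val + 3 * cst e)
    (hd.finiteLength γ (by linarith) (by linarith)) (by linarith)
    (hE.mono fun z hz => ⟨by linarith [hz.1], by linarith [hz.2]⟩)
    (hE.mono fun z hz => by linarith [hz.2]) hγ (by linarith) (by linarith)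
    fun χ A hχ hA => h.hom_to_mid ?_ ?_
  · exact hd.deformedP_hom_eq_zero (PolyPhase.val_lt.mp hχ) hA hX
  · exact hd.deformedP_hom_eq_zero (PolyPhase.val_lt.mp hχ) hA hY

theorem nonempty_hnFiltration (hd : IsDeformation s W e) (E : C) (hE : ¬ IsZero E) :
    Nonempty (HNFiltration (deformedP s W e) E) := by
  have hk := hd.cst_pos
  obtain ⟨F⟩ := s.exists_hn E hE
  have hF := F.in_top
  set α := F.phase (Fin.last F.n) with hα
  set β := F.phase 0 with hβ
  obtain ⟨n, hn⟩ := exists_nat_gt ((β.infty - α.infty + 2 * e) / e)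
  rw [div_lt_iff₀ hd.pos] at hn
  have hv : (α + (-e)).val = α.val - cst e := by
    rw [PolyPhase.val_add, map_neg, sub_eq_add_neg]
  have hβα : β.val + 2 * cst e < α.val + n * cst e := by
    have : β + (2 * e : ℝ) < α + ((n : ℝ) * e : ℝ) := PolyPhase.lt_of_infty_lt (by
      rw [PolyPhase.infty_add, PolyPhase.infty_add]
      linarith)
    rwa [← PolyPhase.val_lt, PolyPhase.val_add, PolyPhase.val_add, map_mul, map_mul, map_ofNat,
      map_natCast] at this
  have h1 : Tors s W e (α + (-e)).val E :=
    Tors.of_in (hF.mono fun z hz => by rw [hv]; linarith [hz.1])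
  have h2 : TorsFree s W e ((α + (-e)).val + n * cst e) E :=
    TorsFree.of_in (hF.mono fun z hz => by rw [hv]; linarith [hz.2])
  obtain ⟨F', -⟩ := (hd.hasHN_of_tors_of_torsFree n _ h1 h2).exists_hnFiltration hE
  exact ⟨F'⟩

/-- The deformed slicing. -/
noncomputable def slicing (hd : IsDeformation s W e) : PolySlicing C where
  P := deformedP s W e
  containsZero _ := ⟨0, isZero_zero C, Or.inl (isZero_zero C)⟩
  closedIso _ := ⟨fun i h => deformedP_congr h i⟩
  closedExt _ T hT h₁ h₃ := hd.deformedP_ext (IsExt.of_dist T hT) h₁ h₃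
  shift _ _ := deformedP_shift
  hom_eq_zero _ _ h _ _ hA hB f := hd.deformedP_hom_eq_zero h hA hB f
  exists_hn E hE := hd.nonempty_hnFiltration E hE

/-- The deformed stability condition. -/
noncomputable def stabilityCondition (hd : IsDeformation s W e) : PolyStabilityCondition C where
  Z := W
  slicing := hd.slicing
  compat _ _ hE hE0 := (hE.resolve_left hE0).2.1

/-- An interval of radius `e` for the deformed slicing lies in the interval of radius `2 * e` for
the original one, so it inherits finite length. -/
theorem stabilityCondition_isLocallyFinite (hd : IsDeformation s W e) :
    hd.stabilityCondition.IsLocallyFinite := by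
  have hk := hd.cst_pos
  refine ⟨e, hd.pos, by linarith [hd.le], fun φ => ?_⟩
  rw [PolySlicing.isOfFiniteLength_interval_iff _ _ hd.pos (by linarith [hd.le])]
  refine (hd.finite φ).of_imp fun E hE => ExtensionClosure.bind hE fun E hE => ?_
  change s.In _ E
  rcases hE with hE | ⟨ψ, hψ, hE⟩
  · exact In.of_isZero hE
  · exact (deformedP_in hE).mono fun z hz =>
      ⟨by linarith [hz.1, hψ.1], by linarith [hz.2, hψ.2]⟩

end IsDeformation

/-! ### The deformation theorem -/

/-- A bound on the seminorm bounds the change of phase of semistable objects. -/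
theorem exists_hasPhase_of_seminorm_lt (σ : PolyStabilityCondition C)
    (W : TriangulatedK0 C →+ ℂ[X]) {e : ℝ} (he : 0 < e) (he' : e < 1 / 2)
    (h : σ.seminorm (W - σ.Z) < ENNReal.ofReal (Real.sin (Real.pi * e))) (φ : PolyPhase) (E : C)
    (hE : σ.slicing.P φ E) (hE0 : ¬ IsZero E) :
    ∃ χ : PolyPhase, HasPhase W E χ ∧ φ.val - cst e < χ.val ∧ χ.val < φ.val + cst e := by
  refine (σ.compat φ E hE hE0).exists_of_norm_sub_lt he he' ?_
  have hlim : limsup (fun m : ℝ => ENNReal.ofReal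
      (‖((W - σ.Z) (k0Class E)).eval (m : ℂ)‖ / ‖(σ.Z (k0Class E)).eval (m : ℂ)‖)) atTop <
      ENNReal.ofReal (Real.sin (Real.pi * e)) :=
    lt_of_le_of_lt (le_trans (le_iSup₂_of_le (f := fun (_ : σ.slicing.P φ E) (_ : ¬ IsZero E) => _)
      hE hE0 le_rfl) (le_iSup₂_of_le (f := fun (φ : PolyPhase) (E : C) =>
        ⨆ (_ : σ.slicing.P φ E) (_ : ¬ IsZero E), limsup (fun m : ℝ => ENNReal.ofReal
          (‖((W - σ.Z) (k0Class E)).eval (m : ℂ)‖ / ‖(σ.Z (k0Class E)).eval (m : ℂ)‖)) atTop)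
      φ E le_rfl)) h
  filter_upwards [eventually_lt_of_limsup_lt hlim,
    PolyPhase.isPhaseOf_iff.mp (σ.compat φ E hE hE0)] with m hm hZ
  obtain ⟨r, hr, hZ⟩ := hZ
  have hpos : 0 < ‖(σ.Z (k0Class E)).eval (m : ℂ)‖ := by
    rw [hZ, norm_pos_iff]
    exact mul_ne_zero (by exact_mod_cast hr.ne') (Complex.exp_ne_zero _)
  rw [ENNReal.ofReal_lt_ofReal_iff (sin_pi_mul_pos he (by linarith)), div_lt_iff₀ hpos,
    AddMonoidHom.sub_apply, Polynomial.eval_sub] at hm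
  exact hm

theorem isDeformation_of_seminorm_lt [IsTriangulated C] (σ : PolyStabilityCondition C) {η : ℝ}
    (hη : η ≤ 1 / 2) (hfin : ∀ φ : PolyPhase,
      IsOfFiniteLength (σ.slicing.interval (Set.Ioo (φ + (-η)) (φ + η))).FullSubcategory)
    (W : TriangulatedK0 C →+ ℂ[X]) {e : ℝ} (he : 0 < e) (he' : 16 * e ≤ η)
    (h : σ.seminorm (W - σ.Z) < ENNReal.ofReal (Real.sin (Real.pi * e))) :
    IsDeformation σ.slicing W e where
  pos := he
  le := by linarith
  exists_phase := exists_hasPhase_of_seminorm_lt σ W he (by linarith) h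
  finite φ := by
    have h1 := (PolySlicing.isOfFiniteLength_interval_iff σ.slicing φ (by linarith) hη).mp (hfin φ)
    have h2 : 16 * cst e ≤ cst η := by
      rw [← map_ofNat cst 16, ← map_mul, cst_le]
      exact he'
    exact h1.of_imp fun E hE => hE.mono fun z hz => ⟨by linarith [hz.1], by linarith [hz.2]⟩

end Slicing

theorem mainTheorem7 {C : Type u} [Category.{v} C] [HasZeroObject C] [HasShift C ℤ]
    [Preadditive C] [∀ n : ℤ, (shiftFunctor C n).Additive] [Pretriangulated C] [IsTriangulated C]
    (σ : PolyStabilityCondition C) (hσ : σ.IsLocallyFinite) :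
    ∃ ε : ℝ, 0 < ε ∧ ε < 1 / 4 ∧
      ∀ W : TriangulatedK0 C →+ ℂ[X],
        σ.seminorm (W - σ.Z) < ENNReal.ofReal (Real.sin (Real.pi * ε)) →
        ∃ τ : PolyStabilityCondition C, τ.Z = W ∧ τ.IsLocallyFinite ∧
          σ.slicing.dist τ.slicing < ENNReal.ofReal ε := by
  obtain ⟨η, hη0, hη1, hfin⟩ := hσ
  refine ⟨η / 16, by positivity, by linarith, fun W hW => ?_⟩
  -- the bound on the seminorm is strict, so it still holds for some `e` smaller than `η / 16`
  have hcont : Tendsto (fun e : ℝ => ENNReal.ofReal (Real.sin (Real.pi * e))) (𝓝[<] (η / 16))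
      (𝓝 (ENNReal.ofReal (Real.sin (Real.pi * (η / 16))))) := by
    have : Continuous fun e : ℝ => ENNReal.ofReal (Real.sin (Real.pi * e)) :=
      ENNReal.continuous_ofReal.comp (by fun_prop)
    exact (this.tendsto _).mono_left nhdsWithin_le_nhds
  obtain ⟨e, he, he0, heη⟩ := ((hcont.eventually_const_lt hW).and
    (Ioo_mem_nhdsLT (show (0 : ℝ) < η / 16 by positivity))).exists
  have hd := isDeformation_of_seminorm_lt σ hη1 hfin W he0 (by linarith) he
  refine ⟨hd.stabilityCondition, rfl, hd.stabilityCondition_isLocallyFinite, ?_⟩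
  refine lt_of_le_of_lt (PolySlicing.dist_le fun ψ E hE => IsDeformation.deformedP_in hE) ?_
  exact (ENNReal.ofReal_lt_ofReal_iff (by positivity)).mpr heη
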